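/- A (finite) map $\mathcal M$ is a 2-cell embedding of a finite connected graph with at least one edge (loops and multiple edges allowed) in a closed surface, orientable or not; $V$, $E$, $F$ are its sets of vertices, edges and faces, and $\chi=|V|-|E|+|F|$. Every edge lies in exactly four flags, and $\mathrm{Aut}(\mathcal M)$ is the group of permutations of the flags that preserve adjacency of flags (that is, the relations of differing only in the vertex, only in the edge, only in the face). Write $\mathbb Z_k$ for the cyclic group of order $k$, $D_{2k}$ for the dihedral group of order $2k$ (so $D_4\cong\mathbb Z_2^2$), and $A{:}B$ for a split extension, that is, a semidirect product of a normal subgroup $A$ by a complement $B$. Theorem. Let $\mathcal M=(V,E,F)$ be a map with $\gcd(|E|,\chi)=1$, and let $G\le\mathrm{Aut}(\mathcal M)$ be solvable and transitive on $E$. Then at least one of the following holds, for some positive integers $m,n$: (1) $G\cong\mathbb Z_n{:}\mathbb Z_m$, with $\gcd(m,n)=1$ or $2$; (2) $G\cong\mathbb Z_n{:}(D_{2^e}\times\mathbb Z_m)$ for some $e\ge 2$, with $\gcd(m,n)=1$ and $mn$ odd; (3) $G\cong(\mathbb Z_n\times D_4){:}\mathbb Z_m$, with $\gcd(m,n)=1$,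 $mn$ odd and $3\mid m$, and there is a surjective homomorphism $G\to A_4$; (4) $G\cong(\mathbb Z_n\times D_4){:}(D_{2\cdot 3^f}\times\mathbb Z_m)$ for some $f\ge 1$, with $\gcd(m,n)=1$ and $mn$ odd, and there is a surjective homomorphism $G\to S_4$. -/

import Mathlib

/-- A map, i.e. a 2-cell embedding of a connected graph with at least one edge in a connected
surface without boundary, orientable or not, described by its set `Ω` of flags (a finite map in a
closed surface if `Ω` is finite).  `s 0`, `s 1`, `s 2` send a flag `(v, e, f)` to the adjacent flag
that differs from it in the vertex, in the edge, in the face, respectively.  Loops, multiple edges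
and vertices or faces of small valency are allowed (so a flag need not be determined by its
triple); free edges and boundary are not.  Every edge lies in exactly four flags. -/
structure SurfaceMap (Ω : Type*) where
  s : Fin 3 → Equiv.Perm Ω
  invol : ∀ i x, s i (s i x) = x
  fixedPointFree : ∀ i x, s i x ≠ x
  comm : ∀ x, s 0 (s 2 x) = s 2 (s 0 x)
  fixedPointFree' : ∀ x, s 0 (s 2 x) ≠ x
  nonempty : Nonempty Ω
  connected : ∀ x y, ∃ g ∈ Subgroup.closure (Set.range s), g x = y

namespace SurfaceMap

variable {Ω : Type*} (M : SurfaceMap Ω)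

/-- Cells of dimension `i`: classes of flags under the group generated by the two adjacency
involutions that do not change the cell of dimension `i`. -/
def Cell (i : Fin 3) : Type _ :=
  MulAction.orbitRel.Quotient (Subgroup.closure (M.s '' {j | j ≠ i})) Ω

/-- The vertices. -/
abbrev Vertex : Type _ := M.Cell 0

/-- The edges. -/
abbrev Edge : Type _ := M.Cell 1

/-- The faces. -/
abbrev Face : Type _ := M.Cell 2

/-- The number of edges. -/
noncomputable def numEdges : ℕ := Nat.card M.Edge

/-- The Euler characteristic `|V| - |E| + |F|` (meaningful for finite `Ω`). -/
noncomputable def eulerChar : ℤ :=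
  (Nat.card M.Vertex : ℤ) - (Nat.card M.Edge : ℤ) + (Nat.card M.Face : ℤ)

/-- The automorphism group: the permutations of the flags that preserve all three
adjacency relations. -/
def aut : Subgroup (Equiv.Perm Ω) where
  carrier := {g | ∀ i x, g (M.s i x) = M.s i (g x)}
  mul_mem' := by
    intro a b ha hb i x
    simp only [Set.mem_ofPred_eq] at ha hb
    simp [ha, hb]
  one_mem' := by
    intro i x
    rfl
  inv_mem' := by
    intro a ha i x
    simp only [Set.mem_ofPred_eq] at ha
    rw [Equiv.Perm.inv_eq_iff_eq, ha]
    simp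

theorem aut_comm_closure (g : M.aut) (t : Set (Fin 3)) {h : Equiv.Perm Ω}
    (hh : h ∈ Subgroup.closure (M.s '' t)) (x : Ω) :
    (g : Equiv.Perm Ω) (h x) = h ((g : Equiv.Perm Ω) x) := by
  induction hh using Subgroup.closure_induction generalizing x with
  | mem y hy =>
    obtain ⟨j, -, rfl⟩ := hy
    exact g.2 j x
  | one => rfl
  | mul a b _ _ ha hb => simp [ha, hb]
  | inv a _ ha =>
    rw [Equiv.Perm.eq_inv_iff_eq, ← ha]
    simp

/-- The action of an automorphism on the cells of dimension `i`, induced by its action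
on flags. -/
def cellMap (g : M.aut) (i : Fin 3) : M.Cell i → M.Cell i :=
  Quotient.map (g : Equiv.Perm Ω) (by
    rintro x y ⟨⟨h, hh⟩, hxy⟩
    refine ⟨⟨h, hh⟩, ?_⟩
    change h y = x at hxy
    change h ((g : Equiv.Perm Ω) y) = (g : Equiv.Perm Ω) x
    rw [← hxy, M.aut_comm_closure g _ hh])

/-- A group of automorphisms is edge-transitive if it has a single orbit on the edges. -/
def IsEdgeTransitive (G : Subgroup M.aut) : Prop :=
  ∀ e e' : M.Edge, ∃ g ∈ G, M.cellMap g 1 e = e'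

end SurfaceMap

/-- `G = A : B`, i.e. `G` is the (internal) semidirect product of a normal subgroup isomorphic
to `A` and a complement isomorphic to `B`. -/
def IsSplitExtension (G A B : Type*) [Group G] [Group A] [Group B] : Prop :=
  ∃ N H : Subgroup G, N.Normal ∧ N.IsComplement' H ∧ Nonempty (N ≃* A) ∧ Nonempty (H ≃* B)

/-- The cyclic group of order `n` (for `n ≥ 1`), written multiplicatively. -/
abbrev Cyc (n : ℕ) : Type := Multiplicative (ZMod n)

/-! A prime `p` dividing all of |V|, |E| and |F| would divide both |E| and χ. So for every prime `p`
one of the three numbers is prime to `p`, and a Sylow `p`-subgroup `P` of `G`, having orbits of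
`p`-power length, fixes a vertex, an edge or a face. By connectedness an automorphism fixing a flag
is trivial, and the flags at the fixed cell form one orbit of the dihedral group generated by two
adjacency involutions, which commute with `P`. Hence `P` has a cyclic subgroup of rotations of index
at most two, and all its other elements are involutions (`hasDihedralTypeSylows`).

What remains is a theorem on finite solvable groups with such Sylow subgroups
(`HasDihedralTypeSylows.classification`). If all Sylow subgroups are cyclic, the commutator subgroup
is a cyclic Hall subgroup with a cyclic complement. Otherwise induction over a normal `p`-subgroup
(`normal_dichotomy`) gives a normal 2-complement or a normal four-group `V` moved by an element of
odd order; the point is that no other 2-group of dihedral type has a nontrivial automorphism of odd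
order.

With a normal 2-complement `O`, the group G' ∩ O is a cyclic Hall subgroup, and a complement of it
is a Sylow 2-subgroup times a central cyclic group. With a moved four-group, a Sylow 2-subgroup has
order 4 or 8, and `V` has a complement `K` (by Schur-Zassenhaus, or as the normaliser of a Sylow
3-subgroup). All Sylow subgroups of `K` are cyclic, which gives its structure, and the action of `G`
on the four cosets of `K` gives the map onto A₄ or S₄. -/

/-! ### Groups of dihedral type, their subgroups, quotients and isomorphism types -/

/-- A group of dihedral type has a cyclic subgroup of index at most two outside of which all
elements are involutions; it is cyclic or (generalised) dihedral. -/
def IsDihedralType (S : Type*) [Group S] : Prop :=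
  ∃ C : Subgroup S, IsCyclic C ∧ C.index ∣ 2 ∧ ∀ x ∉ C, x * x = 1

/-- All Sylow subgroups of the group are of dihedral type. -/
def HasDihedralTypeSylows (G : Type*) [Group G] : Prop :=
  ∀ p : ℕ, p.Prime → ∀ P : Sylow p G, IsDihedralType P

theorem Subgroup.normal_of_index_dvd_two {S : Type*} [Group S] {C : Subgroup S}
    (h : C.index ∣ 2) : C.Normal := by
  rcases (Nat.dvd_prime Nat.prime_two).1 h with h | h
  · rw [Subgroup.index_eq_one] at h
    subst h
    infer_instance
  · exact Subgroup.normal_of_index_eq_two h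

theorem IsDihedralType.of_injective {S T : Type*} [Group S] [Group T] (hT : IsDihedralType T)
    (f : S →* T) (hf : Function.Injective f) : IsDihedralType S := by
  obtain ⟨C, hC, hi, hinv⟩ := hT
  have := Subgroup.normal_of_index_dvd_two hi
  refine ⟨C.comap f, ?_, ?_, fun x hx => hf ?_⟩
  · refine isCyclic_of_injective (f.subgroupComap C) fun a b hab => ?_
    exact Subtype.ext (hf (congrArg Subtype.val hab))
  · rw [Subgroup.index_comap]
    exact (Subgroup.relIndex_dvd_index_of_normal _ _).trans hi
  · rw [map_mul, map_one]
    exact hinv _ hx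

theorem IsDihedralType.of_surjective {S T : Type*} [Group S] [Group T] (hS : IsDihedralType S)
    (f : S →* T) (hf : Function.Surjective f) : IsDihedralType T := by
  obtain ⟨C, hC, hi, hinv⟩ := hS
  refine ⟨C.map f, ?_, (C.index_map_dvd hf).trans hi, fun x hx => ?_⟩
  · exact isCyclic_of_surjective (f.subgroupMap C) (f.subgroupMap_surjective C)
  · obtain ⟨y, rfl⟩ := hf x
    rw [← map_mul, hinv y (fun h => hx (Subgroup.mem_map_of_mem f h)), map_one]

theorem IsDihedralType.isCyclic_of_odd {S : Type*} [Group S] [Finite S] (hS : IsDihedralType S)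
    (hodd : Odd (Nat.card S)) : IsCyclic S := by
  obtain ⟨C, hC, hi, hinv⟩ := hS
  rcases (Nat.dvd_prime Nat.prime_two).1 hi with h | h
  · rw [Subgroup.index_eq_one] at h
    subst h
    exact isCyclic_of_surjective _ Subgroup.topEquiv.surjective
  · have := C.index_dvd_card
    rw [h] at this
    exact absurd this hodd.not_two_dvd_nat

theorem HasDihedralTypeSylows.of_isPGroup {G : Type*} [Group G] (hG : HasDihedralTypeSylows G)
    {p : ℕ} (hp : p.Prime) {P : Subgroup G} (hP : IsPGroup p P) : IsDihedralType P := by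
  obtain ⟨Q, hQ⟩ := hP.exists_le_sylow
  exact (hG p hp Q).of_injective _ (Subgroup.inclusion_injective hQ)

theorem HasDihedralTypeSylows.of_surjective {G H : Type*} [Group G] [Group H] [Finite G]
    (hG : HasDihedralTypeSylows G) (f : G →* H) (hf : Function.Surjective f) :
    HasDihedralTypeSylows H := by
  intro p hp P
  have : Fact p.Prime := ⟨hp⟩
  obtain ⟨Q, rfl⟩ := Sylow.mapSurjective_surjective hf p P
  exact (hG p hp Q).of_surjective (f.subgroupMap Q) (f.subgroupMap_surjective Q)

theorem HasDihedralTypeSylows.isCyclic {G : Type*} [Group G] [Finite G]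
    (hG : HasDihedralTypeSylows G) {p : ℕ} (hp : p.Prime) (hp2 : p ≠ 2) {P : Subgroup G}
    (hP : IsPGroup p P) : IsCyclic P := by
  have : Fact p.Prime := ⟨hp⟩
  obtain ⟨k, hk⟩ := IsPGroup.iff_card.1 hP
  refine (hG.of_isPGroup hp hP).isCyclic_of_odd ?_
  rw [hk]
  exact (hp.odd_of_ne_two hp2).pow

/-- A group with a cyclic subgroup of index two, all of whose other elements are involutions,
is dihedral. -/
theorem nonempty_mulEquiv_dihedralGroup {S : Type*} [Group S] [Finite S] {C : Subgroup S}
    (hC : IsCyclic C) (hi : C.index = 2) (hinv : ∀ x ∉ C, x * x = 1) :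
    Nonempty (S ≃* DihedralGroup (Nat.card C)) := by
  obtain ⟨⟨c, hc⟩, hgen⟩ := hC.exists_generator
  set n := Nat.card C with hn
  have hn0 : n ≠ 0 := Nat.card_pos.ne'
  have : NeZero n := ⟨hn0⟩
  have hcn : c ^ n = 1 := by
    have := pow_card_eq_one' (x := (⟨c, hc⟩ : C))
    exact congrArg Subtype.val this
  obtain ⟨s, hs⟩ : ∃ s, s ∉ C := by
    by_contra! h
    have : C = ⊤ := by ext; simp [h]
    rw [this, Subgroup.index_top] at hi
    omega
  have hs1 : s⁻¹ = s := inv_eq_of_mul_eq_one_left (hinv s hs)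
  have hconj : s * c * s = c⁻¹ := by
    have h1 : s * c ∉ C := fun h => hs ((C.mul_mem_cancel_right hc).1 h)
    have := hinv _ h1
    rw [eq_inv_iff_mul_eq_one]
    simpa [mul_assoc] using this
  -- Exponents may be read modulo `n` because `c ^ n = 1`; this makes `e` additive.
  let e : ZMod n → S := fun i => c ^ i.val
  have he_add (i j : ZMod n) : e (i + j) = e i * e j := by
    simp only [e]
    rw [← pow_add, pow_eq_pow_iff_modEq, ZMod.val_add]
    exact (Nat.mod_modEq _ _).of_dvd (orderOf_dvd_of_pow_eq_one hcn)
  have he_zero : e 0 = 1 := by simp [e]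
  have he_neg (i : ZMod n) : e (-i) = (e i)⁻¹ := by
    rw [eq_inv_iff_mul_eq_one, ← he_add]
    simp [e]
  have he_sub (i j : ZMod n) : e (i - j) = (e j)⁻¹ * e i := by
    rw [sub_eq_neg_add, he_add, he_neg]
  have hes (i : ZMod n) : e i * s = s * (e i)⁻¹ := by
    have h2 : s * c * s⁻¹ = c⁻¹ := by rw [hs1, hconj]
    have h3 : s * (c ^ i.val) * s⁻¹ = (c ^ i.val)⁻¹ := by
      rw [← conj_pow, h2, inv_pow]
    have h4 : s * (c ^ i.val)⁻¹ * s⁻¹ = c ^ i.val := by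
      rw [← conj_inv, h3, inv_inv]
    calc e i * s = (s * (c ^ i.val)⁻¹ * s⁻¹) * s := by rw [h4]
      _ = _ := by simp [e]
  let f : DihedralGroup n → S := fun x => match x with
    | .r i => e i
    | .sr i => s * e i
  have hf_mul : ∀ x y, f (x * y) = f x * f y := by
    have hss : s * s = 1 := hinv s hs
    rintro (i | i) (j | j)
    · simp only [DihedralGroup.r_mul_r, f, he_add]
    · simp only [DihedralGroup.r_mul_sr, f, he_sub]
      rw [← mul_assoc, ← mul_assoc, hes]
    · simp only [DihedralGroup.sr_mul_r, f, he_add, mul_assoc]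
    · simp only [DihedralGroup.sr_mul_sr, f, he_sub]
      rw [← mul_assoc, mul_assoc s, hes, ← mul_assoc, hss, one_mul]
  let F : DihedralGroup n →* S := MonoidHom.mk' f hf_mul
  have hsurj : Function.Surjective F := by
    have key : ∀ x ∈ C, ∃ i, e i = x := by
      intro x hx
      obtain ⟨k, hk⟩ := (mem_powers_iff_mem_zpowers.2 (hgen ⟨x, hx⟩))
      have hk' : c ^ k = x := congrArg Subtype.val hk
      refine ⟨(k : ZMod n), ?_⟩
      simp only [e, ZMod.val_natCast]
      rw [← hk', pow_eq_pow_iff_modEq]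
      exact (Nat.mod_modEq _ _).of_dvd (orderOf_dvd_of_pow_eq_one hcn)
    intro x
    by_cases hx : x ∈ C
    · obtain ⟨i, hi⟩ := key x hx
      exact ⟨.r i, hi⟩
    · have : s⁻¹ * x ∈ C := by
        rw [hs1, Subgroup.mul_mem_iff_of_index_two hi]
        simp [hs, hx]
      obtain ⟨i, hi⟩ := key _ this
      refine ⟨.sr i, ?_⟩
      change s * e i = x
      rw [hi]; simp
  have hcard : Nat.card (DihedralGroup n) = Nat.card S := by
    rw [DihedralGroup.nat_card, ← C.card_mul_index, hi, mul_comm]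
  exact ⟨(MulEquiv.ofBijective F
    ((Nat.bijective_iff_surjective_and_card F).2 ⟨hsurj, hcard⟩)).symm⟩

theorem IsDihedralType.nonempty_mulEquiv {S : Type*} [Group S] [Finite S]
    (hS : IsDihedralType S) (h2 : IsPGroup 2 S) (hnc : ¬ IsCyclic S) :
    ∃ e, 2 ≤ e ∧ Nonempty (S ≃* DihedralGroup (2 ^ (e - 1))) := by
  obtain ⟨C, hC, hi, hinv⟩ := hS
  rcases (Nat.dvd_prime Nat.prime_two).1 hi with h | h
  · rw [Subgroup.index_eq_one] at h
    subst h
    exact absurd (isCyclic_of_surjective _ Subgroup.topEquiv.surjective) hnc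
  have : Fact (Nat.Prime 2) := ⟨Nat.prime_two⟩
  obtain ⟨k, hk⟩ := IsPGroup.iff_card.1 (h2.to_subgroup C)
  obtain ⟨φ⟩ := nonempty_mulEquiv_dihedralGroup hC h hinv
  rw [hk] at φ
  -- `S` has order 2^(k+1), and `DihedralGroup j` has order 2j. The case k = 0 would make `S` cyclic
  -- of order 2.
  refine ⟨k + 1, ?_, ⟨φ⟩⟩
  rcases k with _ | k
  · have hcS : Nat.card S = 2 := by
      rw [← C.card_mul_index, hk, h]; rfl
    exact absurd (isCyclic_of_prime_card hcS) hnc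
  · omega

/-! ### Automorphisms of odd order of 2-groups of dihedral type -/

/-- Conjugation by `x` is an automorphism of `C` whose order divides both the order of `x` and |Aut
C| = φ(|C|). -/
theorem Subgroup.commute_of_coprime_totient {G : Type*} [Group G] [Finite G] {C : Subgroup G}
    (hC : IsCyclic C) {x : G} (hx : x ∈ Subgroup.normalizer (C : Set G))
    (hcop : (orderOf x).Coprime (Nat.totient (Nat.card C))) {c : G} (hc : c ∈ C) :
    Commute x c := by
  set y : MulAut C := Subgroup.normalizerMonoidHom C ⟨x, hx⟩ with hy
  have h1 : orderOf y ∣ orderOf x := by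
    have := orderOf_map_dvd (Subgroup.normalizerMonoidHom C) ⟨x, hx⟩
    rwa [Subgroup.orderOf_mk] at this
  have h2 : orderOf y ∣ Nat.totient (Nat.card C) := by
    rw [← IsCyclic.card_mulAut C]
    exact _root_.orderOf_dvd_natCard y
  have h3 : y = 1 := orderOf_eq_one_iff.1 (Nat.eq_one_of_dvd_coprimes hcop h1 h2)
  have h4 := congrArg Subtype.val (DFunLike.congr_fun h3 ⟨c, hc⟩)
  change x * c * x⁻¹ = c at h4
  exact mul_inv_eq_iff_eq_mul.1 h4

/-- The power of `x` with exponent the index lies in `K`, and by coprimality `x` is a power of it.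
-/
theorem Subgroup.mem_of_coprime_index {G : Type*} [Group G] (K : Subgroup G) [K.Normal] {x : G}
    (h : (orderOf x).Coprime K.index) : x ∈ K := by
  obtain ⟨m, hm⟩ := exists_pow_eq_self_of_coprime h.symm
  rw [← hm]
  exact pow_mem (K.pow_index_mem x) m

theorem isCyclic_of_card_le_three {G : Type*} [Group G] [Finite G] (h : Nat.card G ≤ 3) :
    IsCyclic G := by
  have h0 : 0 < Nat.card G := Nat.card_pos
  interval_cases hG : Nat.card G
  · have := (Nat.card_eq_one_iff_unique.1 hG).1
    infer_instance
  · exact isCyclic_of_prime_card (p := 2) hG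
  · exact isCyclic_of_prime_card (p := 3) hG

/-- The automorphism group of a cyclic 2-group is itself a 2-group. -/
theorem Subgroup.mem_centralizer_of_isCyclic_two {G : Type*} [Group G] [Finite G]
    {C : Subgroup G} (hC : IsCyclic C) (h2 : IsPGroup 2 C) {x : G} (hx : x ∈ Subgroup.normalizer (C : Set G))
    (hodd : Odd (orderOf x)) : x ∈ Subgroup.centralizer (C : Set G) := by
  have : Fact (Nat.Prime 2) := ⟨Nat.prime_two⟩
  obtain ⟨k, hk⟩ := IsPGroup.iff_card.1 h2
  refine Subgroup.mem_centralizer_iff.2 fun c hc =>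
    (Subgroup.commute_of_coprime_totient hC hx ?_ hc).eq.symm
  rw [hk]
  rcases k with _ | k
  · simp
  · rw [Nat.totient_prime_pow_succ Nat.prime_two]
    simpa using Nat.Coprime.pow_right k hodd.coprime_two_right

/-- A group of order four is the only `2`-group of dihedral type that can have a non-trivial
automorphism of odd order. -/
theorem IsDihedralType.card_eq_four {G : Type*} [Group G] [Finite G] {T : Subgroup G} [T.Normal]
    (hT : IsDihedralType T) (h2 : IsPGroup 2 T) {x : G} (hodd : Odd (orderOf x))
    (hx : x ∉ Subgroup.centralizer (T : Set G)) : Nat.card T = 4 := by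
  by_contra h4
  apply hx
  have : Fact (Nat.Prime 2) := ⟨Nat.prime_two⟩
  have hTx : x ∈ Subgroup.normalizer (T : Set G) := by rw [Subgroup.normalizer_eq_top]; trivial
  by_cases hcyc : IsCyclic T
  · exact Subgroup.mem_centralizer_of_isCyclic_two hcyc h2 hTx hodd
  obtain ⟨C, hC, hi, hinv⟩ := hT
  have hi2 : C.index = 2 := by
    rcases (Nat.dvd_prime Nat.prime_two).1 hi with h | h
    · rw [Subgroup.index_eq_one] at h
      subst h
      exact absurd (isCyclic_of_surjective _ Subgroup.topEquiv.surjective) hcyc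
    · exact h
  have hcard : Nat.card T = Nat.card C * 2 := by rw [← hi2, C.card_mul_index]
  have hC3 : 3 ≤ Nat.card C := by
    by_contra! hlt
    interval_cases h : Nat.card C
    · exact Nat.card_pos.ne' h
    · exact hcyc (isCyclic_of_card_le_three (by omega))
    · omega
  -- the cyclic subgroup, seen in `G`
  let D : Subgroup G := C.map T.subtype
  have hDT : D ≤ T := Subgroup.map_subtype_le C
  have hD : IsCyclic D :=
    isCyclic_of_surjective (T.subtype.subgroupMap C) (T.subtype.subgroupMap_surjective C)
  have hcardD : Nat.card D = Nat.card C := Subgroup.card_map_of_injective T.subtype_injective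
  have hmemD {y : G} (hy : y ∈ T) : y ∈ D ↔ (⟨y, hy⟩ : T) ∈ C := by
    simp [D, hy]
  have hsq {y : G} (hy : y ∈ T) (hyD : y ∉ D) : y * y = 1 :=
    congrArg Subtype.val (hinv ⟨y, hy⟩ (fun h => hyD ((hmemD hy).2 h)))
  -- A generator of `D` has order at least 3, so its conjugate by `x` cannot be one of the
  -- involutions outside `D`.
  have hDx : x ∈ Subgroup.normalizer (D : Set G) := by
    refine Subgroup.mem_normalizer_fintype ?_
    obtain ⟨⟨c, hc⟩, hgen⟩ := hD.exists_generator
    have hoc : orderOf c = Nat.card D := by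
      rw [← orderOf_eq_card_of_forall_mem_zpowers hgen, Subgroup.orderOf_mk]
    have hcx : x * c * x⁻¹ ∈ D := by
      by_contra hn
      have h1 := hsq ((Subgroup.Normal.conj_mem inferInstance) c (hDT hc) x) hn
      have h2' : c * c = 1 := by
        have : x * (c * c) * x⁻¹ = 1 := by rw [← h1]; group
        rwa [conj_eq_one_iff] at this
      have := Nat.le_of_dvd two_pos (orderOf_dvd_of_pow_eq_one ((pow_two c).trans h2'))
      omega
    intro d hd
    obtain ⟨k, hk⟩ := Subgroup.mem_zpowers_iff.1 (hgen ⟨d, hd⟩)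
    have hk' : c ^ k = d := congrArg Subtype.val hk
    rw [← hk', ← conj_zpow]
    exact zpow_mem hcx k
  have h2D : IsPGroup 2 D := h2.to_le hDT
  have hDc := Subgroup.mem_centralizer_of_isCyclic_two hD h2D hDx hodd
  rw [Subgroup.mem_centralizer_iff] at hDc ⊢
  intro s hs
  by_cases hsD : s ∈ D
  · exact hDc s hsD
  have hsx : x * s * x⁻¹ ∈ T := Subgroup.Normal.conj_mem inferInstance s hs x
  have hsxD : x * s * x⁻¹ ∉ D := fun h =>
    hsD ((Subgroup.mem_normalizer_iff.1 hDx s).2 h)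
  have hcD : x * s * x⁻¹ * s⁻¹ ∈ D := by
    rw [hmemD (mul_mem hsx (inv_mem hs))]
    refine (Subgroup.mul_mem_iff_of_index_two hi2 (a := ⟨_, hsx⟩) (b := ⟨_, inv_mem hs⟩)).2 ?_
    rw [← hmemD, ← hmemD, inv_mem_iff]
    exact iff_of_false hsxD hsD
  -- As `x` centralises `D`, conjugating `s` by the k-th power of `x` gives `c ^ k * s`. So the
  -- order of `c` divides the odd order of `x`; being a power of 2 it is 1.
  set c := x * s * x⁻¹ * s⁻¹ with hcdef
  have hxs : x * s * x⁻¹ = c * s := by simp [hcdef]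
  have hxc : x * c = c * x := (hDc c hcD).symm
  have hpow : ∀ k : ℕ, x ^ k * s = c ^ k * s * x ^ k := by
    intro k
    induction k with
    | zero => simp
    | succ k ih =>
      have h5 : x * c ^ k = c ^ k * x := (Commute.pow_right hxc k).eq
      have h6 : x * s = c * s * x := by rw [← hxs]; group
      calc x ^ (k + 1) * s = x * (x ^ k * s) := by rw [pow_succ' x, mul_assoc]
        _ = (x * c ^ k) * s * x ^ k := by rw [ih]; group
        _ = c ^ k * (x * s) * x ^ k := by rw [h5]; group
        _ = c ^ (k + 1) * s * x ^ (k + 1) := by rw [h6, pow_succ c, pow_succ' x]; group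
  have h7 : c ^ orderOf x = 1 := by
    have := hpow (orderOf x)
    rw [pow_orderOf_eq_one] at this
    simpa using this.symm
  have h8 : orderOf c = 1 := by
    obtain ⟨k, hk⟩ := IsPGroup.iff_orderOf.1 h2D ⟨c, hcD⟩
    rw [Subgroup.orderOf_mk] at hk
    refine Nat.eq_one_of_dvd_coprimes ?_ hk.dvd (orderOf_dvd_of_pow_eq_one h7)
    exact Nat.Coprime.pow_left k hodd.coprime_two_left
  rw [orderOf_eq_one_iff] at h8
  rw [h8, one_mul] at hxs
  rw [← eq_mul_inv_iff_mul_eq, hxs] 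

/-! ### Normal four-groups moved by an element of odd order -/

/-- A normal subgroup of order four on which the group induces a non-trivial automorphism of odd
order; such a subgroup is elementary abelian. -/
def Subgroup.IsMovedKlein {G : Type*} [Group G] (V : Subgroup G) : Prop :=
  V.Normal ∧ Nat.card V = 4 ∧ ∃ x, Odd (orderOf x) ∧ x ∉ Subgroup.centralizer (V : Set G)

namespace Subgroup

variable {G : Type*} [Group G] {V : Subgroup G}

theorem isPGroup_two_of_card_eq_four (h : Nat.card V = 4) : IsPGroup 2 V :=
  IsPGroup.of_card (n := 2) (by rw [h]; rfl)

theorem IsMovedKlein.not_isCyclic [Finite G] (hV : V.IsMovedKlein) : ¬ IsCyclic V := by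
  intro h
  obtain ⟨hn, h4, x, hodd, hx⟩ := hV
  refine hx (mem_centralizer_of_isCyclic_two h (isPGroup_two_of_card_eq_four h4) ?_ hodd)
  rw [normalizer_eq_top]
  trivial

theorem IsMovedKlein.isKleinFour [Finite G] (hV : V.IsMovedKlein) : IsKleinFour V :=
  ⟨hV.2.1, (not_isCyclic_iff_exponent_eq_prime Nat.prime_two (by rw [hV.2.1]; rfl)).1
    hV.not_isCyclic⟩

/-- An element fixing one involution of `V` fixes or swaps the other two, so its square centralises
`V`; an element of odd order is a power of its square. -/
theorem IsMovedKlein.mem_centralizer [Finite G] (hV : V.IsMovedKlein) {x v : G}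
    (hodd : Odd (orderOf x)) (hv : v ∈ V) (hv1 : v ≠ 1) (hxv : x * v = v * x) :
    x ∈ centralizer (V : Set G) := by
  have hK := hV.isKleinFour
  have hn := hV.1
  have hsq : ∀ w ∈ V, w * w = 1 := fun w hw =>
    congrArg Subtype.val (IsKleinFour.mul_self (⟨w, hw⟩ : V))
  have hcomm : ∀ a ∈ V, ∀ b ∈ V, a * b = b * a := fun a ha b hb => by
    have := IsKleinFour.isMulCommutative (G := V)
    exact congrArg Subtype.val (mul_comm' (⟨a, ha⟩ : V) ⟨b, hb⟩)
  rw [mem_centralizer_iff]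
  intro w hw
  by_cases hw1 : w = 1
  · simp [hw1]
  by_cases hwv : w = v
  · rw [hwv, hxv]
  have hxw : x * w * x⁻¹ ∈ V := hn.conj_mem w hw x
  by_cases hxww : x * w * x⁻¹ = w
  · exact (mul_inv_eq_iff_eq_mul.1 hxww).symm
  have hxwv : x * w * x⁻¹ ≠ v := by
    intro h
    apply hwv
    have h1 : v = x * v * x⁻¹ := by rw [hxv]; group
    rw [h1] at h
    simpa using h
  have hxw1 : x * w * x⁻¹ ≠ 1 := by rwa [ne_eq, conj_eq_one_iff]
  have h2 : x * w * x⁻¹ = v * w := by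
    have := IsKleinFour.eq_mul_of_ne_all (x := (⟨v, hv⟩ : V)) (y := ⟨w, hw⟩)
      (z := ⟨x * w * x⁻¹, hxw⟩) (by simpa [Subtype.ext_iff] using hv1)
      (by simpa [Subtype.ext_iff] using hw1)
      (by simpa [Subtype.ext_iff] using Ne.symm hwv)
      (by simpa [Subtype.ext_iff] using hxw1) (by simpa [Subtype.ext_iff] using hxwv)
      (by simpa [Subtype.ext_iff] using hxww)
    exact congrArg Subtype.val this
  have h3 : x ^ 2 * w = w * x ^ 2 := by
    have h4 : x * w = v * w * x := by rw [← h2]; group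
    calc x ^ 2 * w = x * (x * w) := by rw [pow_two, mul_assoc]
      _ = (x * v) * w * x := by rw [h4]; group
      _ = v * (x * w) * x := by rw [hxv]; group
      _ = (v * v) * w * x ^ 2 := by rw [h4, pow_two]; group
      _ = w * x ^ 2 := by rw [hsq v hv, one_mul]
  obtain ⟨m, hm⟩ := exists_pow_eq_self_of_coprime (x := x) (n := 2) hodd.coprime_two_left
  have h5 : Commute (x ^ 2) w := h3
  have := (h5.pow_left m).eq
  rw [hm] at this
  exact this.symm

/-- A normal subgroup of order two would have its only involution fixed by the element of odd order
that moves `V`. -/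
theorem IsMovedKlein.eq_of_le [Finite G] (hV : V.IsMovedKlein) {N : Subgroup G} (hN : N.Normal)
    (hle : N ≤ V) (hne : N ≠ ⊥) : N = V := by
  obtain ⟨hn, h4, x, hodd, hx⟩ := id hV
  have hdvd := card_dvd_of_le hle
  rw [h4] at hdvd
  refine eq_of_le_of_card_ge hle ?_
  rw [h4]
  by_contra! hlt
  have h1 : Nat.card N ≠ 1 := fun h => hne ((card_eq_one).1 h)
  have h2 : Nat.card N = 2 := by
    have h0 : 0 < Nat.card N := Nat.card_pos
    generalize Nat.card N = k at *
    interval_cases k <;> omega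
  obtain ⟨⟨v, hv⟩, hv1⟩ := ne_bot_iff_exists_ne_one.1 hne
  replace hv1 : v ≠ 1 := fun h => hv1 (Subtype.ext h)
  refine hx (hV.mem_centralizer hodd (hle hv) hv1 ?_)
  have hxv : x * v * x⁻¹ ∈ N := hN.conj_mem v hv x
  have hxv1 : x * v * x⁻¹ ≠ 1 := by rwa [ne_eq, conj_eq_one_iff]
  obtain ⟨a, b, hab, huniv⟩ := Nat.card_eq_two_iff.1 h2
  have hall : ∀ y : N, y = a ∨ y = b := fun y => by
    have : y ∈ ({a, b} : Set N) := huniv ▸ Set.mem_univ y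
    simpa using this
  have : (⟨x * v * x⁻¹, hxv⟩ : N) = ⟨v, hv⟩ := by
    have e1 : (⟨x * v * x⁻¹, hxv⟩ : N) ≠ 1 := by simpa [Subtype.ext_iff] using hxv1
    have e2 : (⟨v, hv⟩ : N) ≠ 1 := by simpa [Subtype.ext_iff] using hv1
    rcases hall 1 with h | h <;> rcases hall ⟨x * v * x⁻¹, hxv⟩ with h' | h' <;>
      rcases hall ⟨v, hv⟩ with h'' | h'' <;> simp_all
  have := congrArg Subtype.val this
  change x * v * x⁻¹ = v at this
  exact mul_inv_eq_iff_eq_mul.1 this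

/-- The automorphism group of a cyclic group is abelian, so conjugation on `A` kills commutators. -/
theorem commutator_le_centralizer_of_isCyclic (A : Subgroup G) [A.Normal] (hA : IsCyclic A) :
    _root_.commutator G ≤ centralizer (A : Set G) := by
  let _ := (hA.mulAutMulEquiv _).toMonoidHom.commGroupOfInjective (hA.mulAutMulEquiv _).injective
  refine (Abelianization.commutator_subset_ker (MulAut.conjNormal (H := A))).trans fun g hg => ?_
  rw [mem_centralizer_iff]
  intro a ha
  have h := congrArg Subtype.val (DFunLike.congr_fun (MonoidHom.mem_ker.1 hg) ⟨a, ha⟩)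
  rw [MulAut.conjNormal_apply] at h
  exact (mul_inv_eq_iff_eq_mul.1 h).symm

/-- A normal subgroup of order coprime to its index in a larger normal subgroup has a
complement there that is normal in the whole group, if it centralises the elements of the right
order. -/
theorem exists_normal_complement [Finite G] {A L : Subgroup G} [A.Normal] [L.Normal] (hAL : A ≤ L)
    {m : ℕ} (hcard : Nat.card L = Nat.card A * m) (hcop : (Nat.card A).Coprime m)
    (hcent : ∀ l ∈ L, (orderOf l) ∣ m → l ∈ centralizer (A : Set G)) :
    ∃ W : Subgroup G, W.Normal ∧ W ≤ L ∧ Nat.card W = m ∧ ∀ l ∈ L, ∃ a ∈ A, ∃ w ∈ W, a * w = l := by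
  set A' : Subgroup L := A.subgroupOf L with hA'
  have hcA : Nat.card A' = Nat.card A := Nat.card_congr (subgroupOfEquivOfLe hAL).toEquiv
  have hiA : A'.index = m := by
    have := A'.card_mul_index
    rw [hcA, hcard] at this
    exact Nat.eq_of_mul_eq_mul_left Nat.card_pos this
  obtain ⟨W', hW'⟩ := exists_right_complement'_of_coprime (N := A') (by rwa [hcA, hiA])
  have hcW : Nat.card W' = m := by rw [← hiA, hW'.symm.index_eq_card]
  have hiW : W'.index = Nat.card A := by rw [hW'.index_eq_card, hcA]
  have hprod : ∀ l : L, ∃ a ∈ A', ∃ w ∈ W', a * w = l := fun l => by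
    obtain ⟨⟨a, w⟩, h⟩ := hW'.2 l
    exact ⟨a, a.2, w, w.2, h⟩
  have hcomm : ∀ a ∈ A', ∀ w ∈ W', a * w = w * a := by
    intro a ha w hw
    have hw' : (w : G) ∈ centralizer (A : Set G) := by
      refine hcent w w.2 ?_
      rw [Subgroup.orderOf_coe, ← hcW]
      exact orderOf_dvd_natCard W' hw
    exact Subtype.ext (mem_centralizer_iff.1 hw' a ha)
  have hWn : W'.Normal := by
    refine ⟨fun w hw l => ?_⟩
    obtain ⟨a, ha, u, hu, rfl⟩ := hprod l
    have huw : u * w * u⁻¹ ∈ W' := mul_mem (mul_mem hu hw) (inv_mem hu)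
    have : a * u * w * (a * u)⁻¹ = u * w * u⁻¹ := by
      calc a * u * w * (a * u)⁻¹ = a * (u * w * u⁻¹) * a⁻¹ := by group
        _ = _ := by rw [hcomm a ha _ huw]; group
    rwa [this]
  refine ⟨W'.map L.subtype, ⟨?_⟩, map_subtype_le _, ?_, ?_⟩
  · rintro _ ⟨w, hw, rfl⟩ g
    have hL : g * w * g⁻¹ ∈ L := Normal.conj_mem inferInstance _ w.2 g
    -- `W'` is a normal Hall subgroup of `L`, so it contains every element of `L` of order prime to
    -- |A|, and in particular the conjugates of its own elements.
    refine ⟨⟨_, hL⟩, W'.mem_of_coprime_index ?_, rfl⟩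
    rw [hiW, Subgroup.orderOf_mk]
    refine Nat.Coprime.coprime_dvd_left ?_ hcop.symm
    have h1 : orderOf (g * (w : G) * g⁻¹) = orderOf (w : G) :=
      orderOf_injective (MulAut.conj g).toMonoidHom (MulAut.conj g).injective w
    rw [h1, Subgroup.orderOf_coe, ← hcW]
    exact orderOf_dvd_natCard W' hw
  · rw [card_map_of_injective L.subtype_injective, hcW]
  · intro l hl
    obtain ⟨a, ha, w, hw, h⟩ := hprod ⟨l, hl⟩
    exact ⟨a, ha, w, mem_map_of_mem _ hw, congrArg Subtype.val h⟩

end Subgroup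

/-! ### Lifting through quotients, and the dichotomy for solvable groups -/

theorem card_comap_of_surjective {G H : Type*} [Group G] [Group H] [Finite G] {f : G →* H}
    (hf : Function.Surjective f) (K : Subgroup H) :
    Nat.card (K.comap f) = Nat.card f.ker * Nat.card K := by
  have : Finite H := Finite.of_surjective f hf
  have h1 := (K.comap f).card_mul_index
  have h2 := f.ker.card_mul_index
  rw [K.index_comap_of_surjective hf] at h1
  rw [Subgroup.index_ker, MonoidHom.range_eq_top.2 hf, Subgroup.card_top, ← K.card_mul_index,
    ← mul_assoc] at h2
  exact Nat.eq_of_mul_eq_mul_right (Nat.pos_of_ne_zero K.index_ne_zero_of_finite) (h1.trans h2.symm)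

/-- Raising any preimage to the 2-part of its order makes the order odd; the image loses nothing,
since `x`, of odd order, is a power of the result. -/
theorem exists_lift_of_odd_orderOf {G H : Type*} [Group G] [Group H] [Finite G] {f : G →* H}
    (hf : Function.Surjective f) {K : Subgroup H} {x : H} (hodd : Odd (orderOf x)) (hx : x ∉ K) :
    ∃ y, Odd (orderOf y) ∧ f y ∉ K := by
  obtain ⟨y, rfl⟩ := hf x
  obtain ⟨k, m, hm, hk⟩ := Nat.exists_eq_two_pow_mul_odd (orderOf_pos y).ne'
  refine ⟨y ^ 2 ^ k, ?_, fun h => hx ?_⟩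
  · rw [orderOf_pow, hk, Nat.gcd_eq_right (Dvd.intro _ rfl),
      Nat.mul_div_cancel_left _ (by positivity)]
    exact hm
  · obtain ⟨n, hn⟩ := exists_pow_eq_self_of_coprime (x := f y) (n := 2 ^ k)
      (Nat.Coprime.pow_left k hodd.coprime_two_left)
    rw [← hn]
    rw [map_pow] at h
    exact pow_mem h n

/-- The last nontrivial derived subgroup is abelian, so its Sylow subgroups are characteristic in it
and hence normal in `G`. -/
theorem exists_normal_isPGroup_of_isSolvable {G : Type*} [Group G] [Finite G] [Nontrivial G]
    (hsol : Group.IsSolvable G) :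
    ∃ p : ℕ, p.Prime ∧ ∃ A : Subgroup G, A.Normal ∧ A ≠ ⊥ ∧ IsPGroup p A := by
  classical
  obtain ⟨hn, hmin⟩ := And.intro (Nat.find_spec hsol.solvable) (fun m => Nat.find_min hsol.solvable (m := m))
  set n := Nat.find hsol.solvable
  rcases n with _ | n
  · rw [derivedSeries_zero] at hn
    exact absurd hn top_ne_bot
  set B := derivedSeries G n with hB
  have hB1 : B ≠ ⊥ := hmin n (Nat.lt_succ_self n)
  have hcomm : ∀ a b : B, a * b = b * a := by
    intro a b
    have := Subgroup.commutator_mem_commutator a.2 b.2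
    rw [← derivedSeries_succ, hn, Subgroup.mem_bot, commutatorElement_eq_one_iff_mul_comm] at this
    exact Subtype.ext this
  have hBn : Nat.card B ≠ 1 := fun h => hB1 (Subgroup.card_eq_one.1 h)
  set p := (Nat.card B).minFac
  have hp : p.Prime := Nat.minFac_prime hBn
  have : Fact p.Prime := ⟨hp⟩
  let P : Sylow p B := default
  have hPn : (P : Subgroup B).Normal := ⟨fun x hx g => by
    rw [hcomm g x]; simpa using hx⟩
  have hPc := P.characteristic_of_normal hPn
  refine ⟨p, hp, (P : Subgroup B).map B.subtype, inferInstance, ?_, P.2.map _⟩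
  rw [ne_eq, Subgroup.map_eq_bot_iff_of_injective _ B.subtype_injective]
  exact P.ne_bot_of_dvd_card (Nat.minFac_dvd _)

/-- The property of having a normal `2`-complement. -/
def HasNormalTwoComplement (G : Type*) [Group G] : Prop :=
  ∃ O : Subgroup G, O.Normal ∧ Odd (Nat.card O) ∧ ∃ k, O.index = 2 ^ k

theorem not_mem_centralizer_of_map {G H : Type*} [Group G] [Group H] (f : G →* H) {V : Subgroup G}
    {W : Subgroup H} (hVW : ∀ w ∈ W, ∃ v ∈ V, f v = w) {y : G}
    (hy : f y ∉ Subgroup.centralizer (W : Set H)) : y ∉ Subgroup.centralizer (V : Set G) := by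
  refine fun h => hy (Subgroup.mem_centralizer_iff.2 fun w hw => ?_)
  obtain ⟨v, hv, rfl⟩ := hVW w hw
  rw [← map_mul, ← map_mul, Subgroup.mem_centralizer_iff.1 h v hv]

theorem map_commutator_of_surjective {G H : Type*} [Group G] [Group H] {f : G →* H}
    (hf : Function.Surjective f) : (commutator G).map f = commutator H := by
  rw [commutator_def, commutator_def, Subgroup.map_commutator, Subgroup.map_top_of_surjective f hf]

section Extension

variable {G : Type*} [Group G] [Finite G] {A : Subgroup G} [A.Normal]

theorem card_comap_mk (K : Subgroup (G ⧸ A)) :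
    Nat.card (K.comap (QuotientGroup.mk' A)) = Nat.card A * Nat.card K := by
  rw [card_comap_of_surjective (QuotientGroup.mk'_surjective A), QuotientGroup.ker_mk']

theorem HasNormalTwoComplement.of_quotient_odd (hA : Odd (Nat.card A))
    (h : HasNormalTwoComplement (G ⧸ A)) : HasNormalTwoComplement G := by
  obtain ⟨O, hO, hodd, k, hk⟩ := h
  refine ⟨O.comap (QuotientGroup.mk' A), inferInstance, ?_, k, ?_⟩
  · rw [card_comap_mk]
    exact hA.mul hodd
  · rw [O.index_comap_of_surjective (QuotientGroup.mk'_surjective A), hk]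

/-- In the preimage of `O`, elements of odd order centralise the Hall subgroup `A`, so `A` has there
a complement normal in `G`. -/
theorem HasNormalTwoComplement.of_quotient_two (hA : IsPGroup 2 A)
    (hcent : ∀ x, Odd (orderOf x) → x ∈ Subgroup.centralizer (A : Set G))
    (h : HasNormalTwoComplement (G ⧸ A)) : HasNormalTwoComplement G := by
  obtain ⟨O, hO, hodd, k, hk⟩ := h
  have : Fact (Nat.Prime 2) := ⟨Nat.prime_two⟩
  obtain ⟨j, hj⟩ := IsPGroup.iff_card.1 hA
  have hAL := QuotientGroup.le_comap_mk' A O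
  obtain ⟨W, hW, -, hcW, -⟩ := Subgroup.exists_normal_complement hAL (card_comap_mk O)
    (by rw [hj]; exact Nat.Coprime.pow_left j hodd.coprime_two_left)
    (fun l _ hl => hcent l (hodd.of_dvd_nat hl))
  refine ⟨W, hW, hcW ▸ hodd, j + k, ?_⟩
  have h1 := W.card_mul_index
  have h2 : Nat.card G = Nat.card A * (Nat.card O * O.index) := by
    rw [O.card_mul_index, ← A.card_mul_index]; rfl
  rw [hcW, h2, hj, hk] at h1
  refine Nat.eq_of_mul_eq_mul_left (Nat.card_pos (α := O)) (h1.trans ?_)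
  ring

/-- The image of the centraliser of `A` contains all commutators of the quotient, hence some
nontrivial element [x, v] of `V`; by minimality it contains `V`. So the preimage of `V` centralises
`A`, and its four-group factor is normal in `G`. -/
theorem Subgroup.IsMovedKlein.exists_of_quotient_odd (hA : Odd (Nat.card A)) (hAc : IsCyclic A)
    {V : Subgroup (G ⧸ A)} (hV : V.IsMovedKlein) : ∃ W : Subgroup G, W.IsMovedKlein := by
  obtain ⟨hn, h4, x, hodd, hx⟩ := id hV
  set π := QuotientGroup.mk' A with hπ
  have hsurj : Function.Surjective π := QuotientGroup.mk'_surjective A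
  have hAL : A ≤ V.comap π := QuotientGroup.le_comap_mk' A V
  have hle : V ≤ (centralizer (A : Set G)).map π := by
    have hnm : ((centralizer (A : Set G)).map π).Normal :=
      Normal.map inferInstance _ hsurj
    have := hV.eq_of_le (N := (centralizer (A : Set G)).map π ⊓ V) inferInstance inf_le_right ?_
    · exact inf_eq_right.1 this
    intro hbot
    apply hx
    rw [mem_centralizer_iff]
    intro v (hv : v ∈ V)
    have h1 := commutator_mem_commutator (mem_top x) (mem_top v)
    have h2 : _root_.commutator (G ⧸ A) ≤ (centralizer (A : Set G)).map π := by
      rw [← map_commutator_of_surjective hsurj]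
      exact map_mono (commutator_le_centralizer_of_isCyclic A hAc)
    have h3 : x * v * x⁻¹ * v⁻¹ ∈ (centralizer (A : Set G)).map π ⊓ V :=
      mem_inf.2 ⟨h2 h1, V.mul_mem (hn.conj_mem v hv x) (V.inv_mem hv)⟩
    rw [hbot, mem_bot, mul_inv_eq_one, mul_inv_eq_iff_eq_mul] at h3
    exact h3.symm
  have := hAc.isMulCommutative
  obtain ⟨W, hW, hWL, hcW, hprod⟩ := exists_normal_complement hAL (card_comap_mk V)
    (by rw [h4]; exact Nat.Coprime.pow_right 2 hA.coprime_two_right) (fun l hl _ => by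
      obtain ⟨c, hc, hcl⟩ := hle hl
      have ha : c⁻¹ * l ∈ A := QuotientGroup.eq.1 hcl
      have ha' : c⁻¹ * l ∈ centralizer (A : Set G) := by
        rw [mem_centralizer_iff]
        intro b hb
        exact congrArg Subtype.val (mul_comm' (⟨b, hb⟩ : A) ⟨_, ha⟩)
      have := mul_mem hc ha'
      rwa [mul_inv_cancel_left] at this)
  obtain ⟨y, hyodd, hy⟩ := exists_lift_of_odd_orderOf hsurj hodd hx
  refine ⟨W, hW, hcW.trans h4, y, hyodd, not_mem_centralizer_of_map π (W := V) ?_ hy⟩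
  intro v hv
  obtain ⟨l, rfl⟩ := hsurj v
  obtain ⟨a, ha, w, hw, rfl⟩ := hprod l hv
  refine ⟨w, hw, ?_⟩
  rw [map_mul, (QuotientGroup.eq_one_iff a).2 ha |> fun h => (h : π a = 1), one_mul]

end Extension

/-- A solvable group with Sylow subgroups of dihedral type has a normal `2`-complement or a
normal four-group on which it induces an automorphism of order three. -/
theorem HasDihedralTypeSylows.normal_dichotomy (n : ℕ) {G : Type*} [Group G] [Finite G]
    (hn : Nat.card G = n) (hsol : Group.IsSolvable G) (hG : HasDihedralTypeSylows G) :
    HasNormalTwoComplement G ∨ ∃ V : Subgroup G, V.IsMovedKlein := by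
  induction n using Nat.strong_induction_on generalizing G with
  | _ n ih =>
  subst hn
  rcases subsingleton_or_nontrivial G with hs | hnt
  · refine Or.inl ⟨⊤, inferInstance, ?_, 0, by simp⟩
    rw [Nat.card_unique]
    exact odd_one
  obtain ⟨p, hp, A, hA, hAne, hpA⟩ := exists_normal_isPGroup_of_isSolvable hsol
  have : Fact p.Prime := ⟨hp⟩
  have hsurj := QuotientGroup.mk'_surjective A
  have hA1 : 1 < Nat.card A := A.one_lt_card_iff_ne_bot.2 hAne
  have hlt : Nat.card (G ⧸ A) < Nat.card G := by
    rw [← A.card_mul_index]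
    exact lt_mul_of_one_lt_left (Nat.pos_of_ne_zero A.index_ne_zero_of_finite) hA1
  have hIH := ih _ hlt (G := G ⧸ A) rfl (Group.isSolvable_of_surjective hsurj)
    (hG.of_surjective _ hsurj)
  rcases eq_or_ne p 2 with rfl | hp2
  · by_cases hcent : ∀ x, Odd (orderOf x) → x ∈ Subgroup.centralizer (A : Set G)
    · refine hIH.imp (HasNormalTwoComplement.of_quotient_two hpA hcent) ?_
      rintro ⟨V, hV, h4, x, hodd, hx⟩
      exfalso
      obtain ⟨y, hyodd, hy⟩ := exists_lift_of_odd_orderOf hsurj hodd hx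
      -- The preimage of `V` is a 2-group of dihedral type moved by `y`, so its order should be 4;
      -- but it is 4|A| with |A| > 1.
      have h2L : IsPGroup 2 (V.comap (QuotientGroup.mk' A)) := by
        obtain ⟨j, hj⟩ := IsPGroup.iff_card.1 hpA
        refine IsPGroup.of_card (n := j + 2) ?_
        rw [card_comap_mk, hj, h4, pow_add]
        rfl
      have := (hG.of_isPGroup Nat.prime_two h2L).card_eq_four h2L hyodd
        (not_mem_centralizer_of_map (QuotientGroup.mk' A) (W := V) (fun w hw => by
          obtain ⟨l, rfl⟩ := hsurj w
          exact ⟨l, hw, rfl⟩) hy)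
      rw [card_comap_mk, h4] at this
      omega
    · push Not at hcent
      obtain ⟨x, hodd, hx⟩ := hcent
      exact Or.inr ⟨A, hA, (hG.of_isPGroup Nat.prime_two hpA).card_eq_four hpA hodd hx, x, hodd, hx⟩
  · have hAodd : Odd (Nat.card A) := by
      obtain ⟨j, hj⟩ := IsPGroup.iff_card.1 hpA
      rw [hj]
      exact (hp.odd_of_ne_two hp2).pow
    exact hIH.imp (HasNormalTwoComplement.of_quotient_odd hAodd) fun ⟨V, hV⟩ =>
      hV.exists_of_quotient_odd hAodd (hG.isCyclic hp hp2 hpA)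

/-! ### Cyclic Sylow subgroups, and groups with a normal 2-complement -/

theorem IsCyclic.nonempty_mulEquiv_cyc {X : Type*} [Group X] (h : IsCyclic X) :
    Nonempty (X ≃* Cyc (Nat.card X)) :=
  ⟨(zmodCyclicMulEquiv h).symm⟩

theorem Subgroup.nonempty_mulEquiv_prod {X : Type*} [Group X] [Finite X] {A B : Subgroup X}
    (hcomm : ∀ a ∈ A, ∀ b ∈ B, a * b = b * a) (hdisj : Disjoint A B)
    (hcard : Nat.card A * Nat.card B = Nat.card X) : Nonempty (X ≃* A × B) := by
  have hc : ∀ (a : A) (b : B), Commute (A.subtype a) (B.subtype b) := fun a b =>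
    hcomm a a.2 b b.2
  let f : A × B →* X := A.subtype.noncommCoprod B.subtype hc
  have hinj : Function.Injective f := by
    rw [MonoidHom.noncommCoprod_injective]
    exact ⟨A.subtype_injective, B.subtype_injective, by simpa using hdisj⟩
  exact ⟨(MulEquiv.ofBijective f ((Nat.bijective_iff_injective_and_card f).2
    ⟨hinj, by rw [Nat.card_prod, hcard]⟩)).symm⟩

theorem HasDihedralTypeSylows.of_injective {G H : Type*} [Group G] [Group H]
    (hG : HasDihedralTypeSylows G) (f : H →* G) (hf : Function.Injective f) :
    HasDihedralTypeSylows H := by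
  intro p hp P
  refine (hG.of_isPGroup hp (P.2.map f)).of_injective (f.subgroupMap P) fun a b hab => ?_
  exact Subtype.ext (hf (congrArg Subtype.val hab))

theorem HasDihedralTypeSylows.isZGroup_of_odd {G : Type*} [Group G] [Finite G]
    (hG : HasDihedralTypeSylows G) (hodd : Odd (Nat.card G)) : IsZGroup G := by
  refine ⟨fun p hp P => ?_⟩
  exact (hG p hp P).isCyclic_of_odd (hodd.of_dvd_nat (P : Subgroup G).card_subgroup_dvd_card)

open scoped IsMulCommutative in
-- The abelianization has cyclic Sylow subgroups, so it is cyclic. A group that is cyclic modulo a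
-- central subgroup is abelian, and an abelian group with cyclic Sylow subgroups is cyclic.
theorem IsZGroup.isCyclic_of_commutator_le_center {X : Type*} [Group X] [Finite X] [IsZGroup X]
    (h : commutator X ≤ Subgroup.center X) : IsCyclic X := by
  rw [← Abelianization.ker_of X] at h
  let _ := commGroupOfCyclicCenterQuotient Abelianization.of h
  infer_instance

/-- A finite group all of whose Sylow subgroups are cyclic is a split extension of cyclic groups
of coprime orders. -/
theorem IsZGroup.exists_isSplitExtension (G : Type*) [Group G] [Finite G] [IsZGroup G] :
    ∃ n m : ℕ, 0 < n ∧ 0 < m ∧ Nat.gcd m n = 1 ∧ IsSplitExtension G (Cyc n) (Cyc m) := by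
  have hcop := IsZGroup.coprime_commutator_index G
  obtain ⟨H, hH⟩ := Subgroup.exists_right_complement'_of_coprime hcop
  have hHc : IsCyclic H := by
    have h1 : Abelianization G ≃* H := hH.symm.QuotientMulEquiv
    exact isCyclic_of_surjective _ h1.surjective
  refine ⟨Nat.card (commutator G), Nat.card H, Nat.card_pos, Nat.card_pos, ?_, commutator G, H,
    inferInstance, hH, (IsZGroup.isCyclic_commutator G).nonempty_mulEquiv_cyc,
    hHc.nonempty_mulEquiv_cyc⟩
  rw [← hH.symm.index_eq_card]
  exact hcop.symm

theorem HasDihedralTypeSylows.exists_not_isCyclic {G : Type*} [Group G] [Finite G]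
    (hG : HasDihedralTypeSylows G) (hZ : ¬ IsZGroup G) (S : Sylow 2 G) : ¬ IsCyclic S := by
  have : Fact (Nat.Prime 2) := ⟨Nat.prime_two⟩
  refine fun hS => hZ ⟨fun p hp P => ?_⟩
  rcases eq_or_ne p 2 with rfl | hp2
  · exact isCyclic_of_surjective _ (S.equiv P).surjective
  · exact hG.isCyclic hp hp2 P.2

/-- A group with a normal `2`-complement and Sylow subgroups of dihedral type, not all cyclic. -/
theorem HasNormalTwoComplement.exists_isSplitExtension {G : Type*} [Group G] [Finite G]
    (hG : HasDihedralTypeSylows G) (hZ : ¬ IsZGroup G) (h2 : HasNormalTwoComplement G) :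
    ∃ n m e : ℕ, 2 ≤ e ∧ Nat.gcd m n = 1 ∧ Odd (m * n) ∧
      IsSplitExtension G (Cyc n) (DihedralGroup (2 ^ (e - 1)) × Cyc m) := by
  obtain ⟨O, hO, hodd, k, hk⟩ := h2
  have : Fact (Nat.Prime 2) := ⟨Nat.prime_two⟩
  set N := commutator G ⊓ O with hN
  have hNodd : Odd (Nat.card N) := hodd.of_dvd_nat (Subgroup.card_dvd_of_le inf_le_right)
  -- For odd `p` the Sylow subgroup is cyclic, so `p` cannot divide both |G'| and |G : G'|; and |G'
  -- : N| divides the 2-power |G : O|.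
  have hcop : (Nat.card N).Coprime N.index := by
    by_contra hnc
    obtain ⟨p, hp, hpN, hpi⟩ := Nat.Prime.not_coprime_iff_dvd.1 hnc
    have : Fact p.Prime := ⟨hp⟩
    have hp2 : p ≠ 2 := by
      rintro rfl
      exact hNodd.not_two_dvd_nat hpN
    have hcyc : IsCyclic (default : Sylow p G) := hG.isCyclic hp hp2 (default : Sylow p G).2
    have hnd := (Sylow.not_dvd_card_commutator_or_not_dvd_index_commutator
      (default : Sylow p G)).resolve_left
        (fun h => h (hpN.trans (Subgroup.card_dvd_of_le inf_le_left)))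
    rw [← Subgroup.relIndex_mul_index (inf_le_left : N ≤ commutator G)] at hpi
    rcases hp.dvd_mul.1 hpi with h | h
    · rw [Subgroup.inf_relIndex_left] at h
      have := h.trans (Subgroup.relIndex_dvd_index_of_normal O _)
      rw [hk] at this
      exact hp2 ((Nat.prime_dvd_prime_iff_eq hp Nat.prime_two).1 (hp.dvd_of_dvd_pow this))
    · exact hnd h
  have hNZ : IsZGroup N :=
    (hG.of_injective N.subtype N.subtype_injective).isZGroup_of_odd hNodd
  -- The cyclic group N' is normal in `G`, so it is centralised by G' and therefore by `N`.
  have hNcyc : IsCyclic N := by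
    apply IsZGroup.isCyclic_of_commutator_le_center
    have hM : IsCyclic ((commutator N).map N.subtype) := by
      have := IsZGroup.isCyclic_commutator N
      exact isCyclic_of_surjective _ (N.subtype.subgroupMap_surjective (commutator N))
    have hc := Subgroup.commutator_le_centralizer_of_isCyclic _ hM
    intro x hx
    rw [Subgroup.mem_center_iff]
    intro y
    have hy := Subgroup.mem_centralizer_iff.1 (hc (Subgroup.mem_inf.1 y.2).1)
    exact Subtype.ext (hy x (Subgroup.mem_map_of_mem _ hx)).symm
  obtain ⟨H, hH⟩ := Subgroup.exists_right_complement'_of_coprime hcop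
  set Z := O.subgroupOf H with hZdef
  have hZi : Z.index = 2 ^ k := by
    have h1 : H ⊔ O = ⊤ := by
      rw [eq_top_iff, ← hH.sup_eq_top, sup_comm H]
      exact sup_le_sup_right inf_le_right H
    rw [← hk]
    change O.relIndex H = _
    rw [← Subgroup.relIndex_sup_right, h1, Subgroup.relIndex_top_right]
  have hZodd : Odd (Nat.card Z) :=
    hodd.of_dvd_nat (Subgroup.card_comap_dvd_of_injective O H.subtype H.subtype_injective)
  -- A commutator of an element of `Z` with one of `H` lies in G' ∩ O ∩ H = N ∩ H = 1.
  have hZcent : ∀ z ∈ Z, ∀ h : H, z * h = h * z := by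
    intro z hz h
    have h1 : (z * h * (z : G)⁻¹ * (h : G)⁻¹ : G) ∈ commutator G :=
      Subgroup.commutator_mem_commutator (Subgroup.mem_top (z : G)) (Subgroup.mem_top (h : G))
    have h2 : (z * h * (z : G)⁻¹ * (h : G)⁻¹ : G) ∈ O := by
      have hz' : (z : G) ∈ O := hz
      have := mul_mem hz' (hO.conj_mem _ (inv_mem hz') h)
      rwa [← mul_assoc, ← mul_assoc] at this
    have h3 : (z * h * (z : G)⁻¹ * (h : G)⁻¹ : G) ∈ H := (z * h * z⁻¹ * h⁻¹ : H).2
    have h4 := Subgroup.disjoint_def.1 hH.disjoint (Subgroup.mem_inf.2 ⟨h1, h2⟩) h3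
    rw [mul_inv_eq_one, mul_inv_eq_iff_eq_mul] at h4
    exact Subtype.ext h4
  obtain ⟨P, hP⟩ := Subgroup.exists_right_complement'_of_coprime (N := Z) (by
    rw [hZi]
    exact Nat.Coprime.pow_right k hZodd.coprime_two_right)
  have hPcard : Nat.card P = 2 ^ k := by rw [← hZi, hP.symm.index_eq_card]
  have hP2 : IsPGroup 2 P := IsPGroup.of_card hPcard
  have hHcard : Nat.card H = N.index := hH.symm.index_eq_card.symm
  -- `P` has order |G : O|, so it is a Sylow 2-subgroup of `G`.
  have hPnc : ¬ IsCyclic P := by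
    intro hcyc
    have hPG : IsPGroup 2 (P.map H.subtype) := hP2.map _
    have hcardPG : Nat.card (P.map H.subtype) = 2 ^ k := by
      rw [Subgroup.card_map_of_injective H.subtype_injective, hPcard]
    have hindex : ¬ 2 ∣ (P.map H.subtype).index := by
      have h1 := (P.map H.subtype).card_mul_index
      have h2 := O.card_mul_index
      rw [hk, mul_comm] at h2
      rw [hcardPG, ← h2] at h1
      rw [Nat.eq_of_mul_eq_mul_left (by positivity) h1]
      exact hodd.not_two_dvd_nat
    exact hG.exists_not_isCyclic hZ (hPG.toSylow hindex)
      (isCyclic_of_surjective _ (H.subtype.subgroupMap_surjective P))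
  have hPD : IsDihedralType P :=
    ((hG.of_injective H.subtype H.subtype_injective).of_isPGroup Nat.prime_two hP2)
  obtain ⟨e, he, ⟨φ⟩⟩ := hPD.nonempty_mulEquiv hP2 hPnc
  have hZZ : IsZGroup Z := ((hG.of_injective H.subtype H.subtype_injective).of_injective
    Z.subtype Z.subtype_injective).isZGroup_of_odd hZodd
  have hZcyc : IsCyclic Z := by
    apply IsZGroup.isCyclic_of_commutator_le_center
    intro x _
    rw [Subgroup.mem_center_iff]
    exact fun y => Subtype.ext (hZcent y y.2 x)
  obtain ⟨ψ⟩ := hZcyc.nonempty_mulEquiv_cyc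
  obtain ⟨θ⟩ := Subgroup.nonempty_mulEquiv_prod (fun a _ b hb => (hZcent b hb a).symm)
    hP.symm.disjoint (by rw [mul_comm, hP.card_mul_card])
  refine ⟨Nat.card N, Nat.card Z, e, he, ?_, hZodd.mul hNodd, N, H, inferInstance, hH,
    hNcyc.nonempty_mulEquiv_cyc, ⟨θ.trans (φ.prodCongr ψ)⟩⟩
  refine Nat.Coprime.coprime_dvd_left ?_ hcop.symm
  rw [← hHcard]
  exact Z.card_subgroup_dvd_card

/-! ### Groups with cyclic Sylow subgroups mapping onto S₃ -/

/-- Endomorphisms of a cyclic group are power maps and so preserve every subgroup. -/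
theorem Subgroup.normal_of_le_isCyclic {G : Type*} [Group G] {N T : Subgroup G} [N.Normal]
    (hN : IsCyclic N) (hT : T ≤ N) : T.Normal := by
  refine ⟨fun t ht g => ?_⟩
  obtain ⟨k, hk⟩ := MonoidHom.map_cyclic ((MulAut.conjNormal g : MulAut N) : N →* N)
  have h := congrArg Subtype.val (hk ⟨t, hT ht⟩)
  change g * t * g⁻¹ = t ^ k at h
  rw [h]
  exact zpow_mem ht k

theorem perm_fin_three_not_commutative :
    ¬ ∀ a b : Equiv.Perm (Fin 3), a * b = b * a := by decide

/-- An involution acting non-trivially on a cyclic `3`-group inverts it. -/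
theorem Subgroup.conj_eq_inv_of_involution {G : Type*} [Group G] {T : Subgroup G}
    [T.Normal] (hT : IsCyclic T) {f : ℕ} (hcard : Nat.card T = 3 ^ f) {t : G} (ht : t * t = 1)
    (hne : ¬ ∀ x ∈ T, t * x = x * t) {x : G} (hx : x ∈ T) : t * x * t⁻¹ = x⁻¹ := by
  obtain ⟨k, hk⟩ := MonoidHom.map_cyclic ((MulAut.conjNormal t : MulAut T) : T →* T)
  have hconj : ∀ x ∈ T, t * x * t⁻¹ = x ^ k := fun x hx => congrArg Subtype.val (hk ⟨x, hx⟩)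
  have hpow : ∀ x ∈ T, x ^ (3 ^ f) = 1 := fun x hx => by
    rw [← hcard]
    exact congrArg Subtype.val (pow_card_eq_one' (x := (⟨x, hx⟩ : T)))
  obtain ⟨⟨τ, hτ⟩, hgen⟩ := hT.exists_generator
  have horder : orderOf τ = 3 ^ f := by
    rw [← hcard, ← orderOf_eq_card_of_forall_mem_zpowers hgen, Subgroup.orderOf_mk]
  have hkk : τ ^ (k * k) = τ := by
    rw [zpow_mul, ← hconj _ (zpow_mem hτ k), ← hconj τ hτ]
    have htt : t⁻¹ = t := inv_eq_of_mul_eq_one_left ht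
    calc t * (t * τ * t⁻¹) * t⁻¹ = (t * t) * τ * (t⁻¹ * t⁻¹) := by group
      _ = τ := by rw [htt, ht]; simp
  -- As `t` squares to 1, k² ≡ 1 modulo 3^f. Since 3 cannot divide both k - 1 and k + 1, the prime
  -- power divides one of them: the action is trivial or inversion.
  have hdvd : (3 ^ f : ℤ) ∣ (k - 1) * (k + 1) := by
    have h1 : τ ^ (k * k - 1) = 1 := by rw [zpow_sub_one, hkk, mul_inv_cancel]
    have h2 := orderOf_dvd_iff_zpow_eq_one.2 h1
    rw [horder] at h2
    push_cast at h2
    convert h2 using 1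
    ring
  have hp3 : Prime (3 : ℤ) := Int.prime_three
  have hall {j : ℤ} (hj : (3 ^ f : ℤ) ∣ j) {y : G} (hy : y ∈ T) : y ^ j = 1 := by
    obtain ⟨i, rfl⟩ := hj
    have := hpow y hy
    rw [zpow_mul]
    have h3 : y ^ (3 ^ f : ℤ) = 1 := by exact_mod_cast this
    rw [h3, one_zpow]
  by_cases h3 : (3 : ℤ) ∣ k - 1
  · exfalso
    apply hne
    have hc : IsCoprime (3 ^ f : ℤ) (k + 1) := by
      apply IsCoprime.pow_left
      rw [Int.isCoprime_iff_gcd_eq_one]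
      have : ¬ (3 : ℤ) ∣ k + 1 := by omega
      exact (Int.isCoprime_iff_gcd_eq_one.1 ((hp3.coprime_iff_not_dvd).2 this))
    have hd := hc.dvd_of_dvd_mul_right hdvd
    intro y hy
    have h4 := hall hd hy
    rw [zpow_sub_one, mul_inv_eq_one] at h4
    have := hconj y hy
    rw [h4] at this
    exact mul_inv_eq_iff_eq_mul.1 this
  · have hc : IsCoprime (3 ^ f : ℤ) (k - 1) :=
      IsCoprime.pow_left ((hp3.coprime_iff_not_dvd).2 h3)
    have hd := hc.dvd_of_dvd_mul_left hdvd
    have h4 := hall hd hx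
    rw [zpow_add_one] at h4
    rw [hconj x hx]
    exact eq_inv_of_mul_eq_one_left h4

theorem two_dvd_index_commutator {K : Type*} [Group K]
    (ψ : K →* Equiv.Perm (Fin 3)) (hψ : Function.Surjective ψ) : 2 ∣ (commutator K).index := by
  have hs : Function.Surjective (Equiv.Perm.sign.comp ψ) :=
    (Equiv.Perm.sign_surjective (Fin 3)).comp hψ
  have h1 := Subgroup.index_dvd_of_le
    (Abelianization.commutator_subset_ker (Equiv.Perm.sign.comp ψ))
  rw [Subgroup.index_ker, MonoidHom.range_eq_top.2 hs, Subgroup.card_top] at h1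
  simpa using h1

/-- |K'| is prime to the even number |K : K'|. Were it also prime to 3, K' would have trivial image
in S₃, making S₃ abelian. -/
theorem three_dvd_card_commutator {K : Type*} [Group K] [Finite K] [IsZGroup K]
    (ψ : K →* Equiv.Perm (Fin 3)) (hψ : Function.Surjective ψ) : 3 ∣ Nat.card (commutator K) := by
  by_contra h3
  have h2 : ¬ 2 ∣ Nat.card (commutator K) := fun h =>
    Nat.not_coprime_of_dvd_of_dvd one_lt_two h (two_dvd_index_commutator ψ hψ)
      (IsZGroup.coprime_commutator_index K)
  have hc : (Nat.card (commutator K)).Coprime 6 :=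
    Nat.Coprime.mul_right (n := 3) (m := 2)
      ((Nat.coprime_comm.1 ((Nat.Prime.coprime_iff_not_dvd Nat.prime_two).2 h2)))
      ((Nat.coprime_comm.1 ((Nat.Prime.coprime_iff_not_dvd Nat.prime_three).2 h3)))
  apply perm_fin_three_not_commutative
  intro a b
  have h6 : Nat.card (Equiv.Perm (Fin 3)) = 6 := by
    rw [Nat.card_eq_fintype_card, Fintype.card_perm]; rfl
  have hmap := map_commutator_of_surjective hψ
  have hbot : commutator (Equiv.Perm (Fin 3)) = ⊥ := by
    rw [← Subgroup.card_eq_one]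
    refine Nat.eq_one_of_dvd_coprimes hc ?_ ?_
    · rw [← hmap]
      exact Subgroup.card_map_dvd (commutator K) ψ
    · have := Subgroup.card_subgroup_dvd_card (commutator (Equiv.Perm (Fin 3)))
      rwa [h6] at this
  have := Subgroup.commutator_mem_commutator (Subgroup.mem_top a) (Subgroup.mem_top b)
  rw [← commutator_def, hbot, Subgroup.mem_bot, commutatorElement_eq_one_iff_mul_comm] at this
  exact this

/-- The index of K' is prime to 3, so every 3-element lies in the cyclic group K', whose subgroups
are all normal in `K`. -/
theorem sylow_three_normal {K : Type*} [Group K] [Finite K] [IsZGroup K]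
    (ψ : K →* Equiv.Perm (Fin 3)) (hψ : Function.Surjective ψ)
    (T : Sylow 3 K) : (T : Subgroup K).Normal := by
  have : Fact (Nat.Prime 3) := ⟨Nat.prime_three⟩
  refine Subgroup.normal_of_le_isCyclic (N := commutator K) (IsZGroup.isCyclic_commutator K)
    fun x hx => Subgroup.mem_of_coprime_index _ ?_
  obtain ⟨j, hj⟩ := IsPGroup.iff_orderOf.1 T.2 ⟨x, hx⟩
  rw [Subgroup.orderOf_mk] at hj
  rw [hj]
  exact Nat.Coprime.pow_left _ ((IsZGroup.coprime_commutator_index K).coprime_dvd_left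
    (three_dvd_card_commutator ψ hψ))

/-- The structure of a group of twice odd order with cyclic Sylow subgroups that maps onto the
symmetric group of degree three. -/
theorem IsZGroup.exists_complement_dihedralGroup {K : Type*} [Group K] [Finite K] [IsZGroup K]
    {k : ℕ} (hk : Nat.card K = 2 * k) (hkodd : Odd k)
    (ψ : K →* Equiv.Perm (Fin 3)) (hψ : Function.Surjective ψ) :
    ∃ A H : Subgroup K, A.Normal ∧ IsCyclic A ∧ A ≤ ψ.ker ∧ A.IsComplement' H ∧
      ∃ f m : ℕ, 1 ≤ f ∧ Nat.gcd m (Nat.card A) = 1 ∧ Odd (m * Nat.card A) ∧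
        Nonempty (H ≃* DihedralGroup (3 ^ f) × Cyc m) := by
  set C := commutator K with hC
  have hCcyc : IsCyclic C := IsZGroup.isCyclic_commutator K
  have hcop : (Nat.card C).Coprime C.index := IsZGroup.coprime_commutator_index K
  have h2i : 2 ∣ C.index := two_dvd_index_commutator ψ hψ
  have h3C : 3 ∣ Nat.card C := three_dvd_card_commutator ψ hψ
  obtain ⟨m, hm⟩ := h2i
  obtain ⟨f, n, hn3, hfn⟩ := Nat.exists_eq_pow_mul_and_not_dvd (Nat.card_pos (α := C)).ne' 3
    (by norm_num)
  have hf : 1 ≤ f := by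
    by_contra h
    have : f = 0 := by omega
    rw [this, pow_zero, one_mul] at hfn
    exact hn3 (hfn ▸ h3C)
  have hprod : 3 ^ f * n * m = k := by
    have := C.card_mul_index
    rw [hk, hm, hfn] at this
    linarith
  have hmodd : Odd m := hkodd.of_dvd_nat ⟨_, by rw [← hprod, mul_comm]⟩
  have hnodd : Odd n := hkodd.of_dvd_nat ⟨3 ^ f * m, by rw [← hprod]; ring⟩
  have h3i : Nat.Coprime 3 C.index := hcop.coprime_dvd_left h3C
  have h3m : Nat.Coprime 3 m := h3i.coprime_dvd_right ⟨2, by rw [hm, mul_comm]⟩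
  have hni : n.Coprime C.index := hcop.coprime_dvd_left ⟨3 ^ f, by rw [hfn, mul_comm]⟩
  have hn3' : n.Coprime 3 :=
    Nat.coprime_comm.1 ((Nat.Prime.coprime_iff_not_dvd Nat.prime_three).2 hn3)
  -- the normal cyclic subgroup
  obtain ⟨⟨κ, hκ⟩, hgen⟩ := hCcyc.exists_generator
  have hκo : orderOf κ = 3 ^ f * n := by
    rw [← hfn, ← orderOf_eq_card_of_forall_mem_zpowers hgen, Subgroup.orderOf_mk]
  -- `A` is the 3'-part of the cyclic group K', of order `n`; a complement `H` then meets K' in a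
  -- group `T` of order 3^f.
  set A := Subgroup.zpowers (κ ^ 3 ^ f) with hA
  have hAC : A ≤ C := by
    rw [hA, Subgroup.zpowers_le]
    exact pow_mem hκ _
  have hAn : A.Normal := Subgroup.normal_of_le_isCyclic hCcyc hAC
  have hAcard : Nat.card A = n := by
    rw [hA, Nat.card_zpowers, orderOf_pow, hκo, Nat.gcd_eq_right (Dvd.intro _ rfl),
      Nat.mul_div_cancel_left _ (by positivity)]
  have hAi : A.index = 3 ^ f * C.index := by
    have h1 := A.card_mul_index
    have h2 := C.card_mul_index
    rw [hAcard] at h1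
    rw [hfn] at h2
    refine Nat.eq_of_mul_eq_mul_left hnodd.pos (h1.trans ?_)
    rw [← h2]
    ring
  have hAker : A ≤ ψ.ker := by
    intro a ha
    rw [MonoidHom.mem_ker, ← orderOf_eq_one_iff]
    have h6 : (6 : ℕ).Coprime n :=
      Nat.Coprime.mul_left (m := 2) (n := 3) hnodd.coprime_two_left hn3'.symm
    refine Nat.eq_one_of_dvd_coprimes h6 ?_ ?_
    · have := _root_.orderOf_dvd_natCard (ψ a)
      have h7 : Nat.card (Equiv.Perm (Fin 3)) = 6 := by
        rw [Nat.card_eq_fintype_card, Fintype.card_perm]; rfl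
      rwa [h7] at this
    · refine (orderOf_map_dvd ψ a).trans ?_
      rw [← hAcard]
      exact A.orderOf_dvd_natCard ha
  obtain ⟨H, hH⟩ := Subgroup.exists_right_complement'_of_coprime (N := A) (by
    rw [hAcard, hAi]
    exact Nat.Coprime.mul_right (hn3'.pow_right f) hni)
  have hHcard : Nat.card H = 3 ^ f * C.index := by rw [← hAi, hH.symm.index_eq_card]
  set T := C.subgroupOf H with hT
  have hTi : T.index = C.index := by
    have h1 : H ⊔ C = ⊤ := by
      rw [eq_top_iff, ← hH.sup_eq_top, sup_comm H]
      exact sup_le_sup_right hAC H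
    change C.relIndex H = _
    rw [← Subgroup.relIndex_sup_right, h1, Subgroup.relIndex_top_right]
  have hTcard : Nat.card T = 3 ^ f := by
    have := T.card_mul_index
    rw [hTi, hHcard] at this
    exact Nat.eq_of_mul_eq_mul_right (Nat.pos_of_ne_zero C.index_ne_zero_of_finite) this
  have hTcyc : IsCyclic T := by
    let g : T →* C := (H.subtype.subgroupComap C)
    refine isCyclic_of_injective g fun a b hab => ?_
    have h : ((g a : C) : K) = g b := by rw [hab]
    exact Subtype.ext (Subtype.ext h)
  have hcomm_mem : ∀ a b : H, a * b * a⁻¹ * b⁻¹ ∈ T := fun a b =>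
    Subgroup.commutator_mem_commutator (Subgroup.mem_top (a : K)) (Subgroup.mem_top (b : K))
  obtain ⟨Y, hY⟩ := Subgroup.exists_right_complement'_of_coprime (N := T) (by
    rw [hTcard, hTi]
    exact h3i.pow_left f)
  have hYcard : Nat.card Y = 2 * m := by rw [← hm, ← hTi, hY.symm.index_eq_card]
  -- Commutators of `H` lie in `T`, which meets `Y` trivially, so `Y` is abelian.
  have hYcyc : IsCyclic Y := by
    apply IsZGroup.isCyclic_of_commutator_le_center
    intro a _
    rw [Subgroup.mem_center_iff]
    intro b
    have h1 := hcomm_mem b a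
    have h2 := Subgroup.disjoint_def.1 hY.disjoint h1 (b * a * b⁻¹ * a⁻¹).2
    rw [mul_inv_eq_one, mul_inv_eq_iff_eq_mul] at h2
    exact Subtype.ext h2
  obtain ⟨⟨y, hy⟩, hygen⟩ := hYcyc.exists_generator
  have hyo : orderOf y = 2 * m := by
    rw [← hYcard, ← orderOf_eq_card_of_forall_mem_zpowers hygen]
    exact (Subgroup.orderOf_mk y hy).symm
  have hform : ∀ h : H, ∃ τ ∈ T, ∃ j : ℤ, τ * y ^ j = h := fun h => by
    obtain ⟨⟨τ, z⟩, hz⟩ := hY.2 h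
    obtain ⟨j, hj⟩ := Subgroup.mem_zpowers_iff.1 (hygen z)
    refine ⟨τ, τ.2, j, ?_⟩
    rw [← hz, ← hj]
    rfl
  -- `Y` has order 2m with m odd: `u` generates its odd part, which will be central in `H`, and `t`
  -- is its involution, which will invert `T`.
  set u := y ^ 2 with hu
  set t := y ^ m with ht
  have huo : orderOf u = m := by
    rw [hu, orderOf_pow, hyo, Nat.gcd_eq_right (Dvd.intro _ rfl), Nat.mul_div_cancel_left _ two_pos]
  have hto : orderOf t = 2 := by
    rw [ht, orderOf_pow, hyo, Nat.gcd_eq_right (Dvd.intro_left _ rfl),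
      Nat.mul_div_cancel _ hmodd.pos]
  have htt : t * t = 1 := by
    rw [← pow_two, ← hto, pow_orderOf_eq_one]
  -- |Aut T| = 2·3^(f-1) is prime to `m`.
  have huT : ∀ τ ∈ T, Commute u τ := fun τ hτ => by
    refine Subgroup.commute_of_coprime_totient hTcyc ?_ ?_ hτ
    · rw [Subgroup.normalizer_eq_top]
      trivial
    · rw [huo, hTcard, Nat.totient_prime_pow Nat.prime_three hf]
      exact Nat.Coprime.mul_right (h3m.symm.pow_right _) hmodd.coprime_two_right
  have hucent : ∀ h : H, Commute u h := fun h => by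
    obtain ⟨τ, hτ, j, rfl⟩ := hform h
    exact (huT τ hτ).mul_right (((Commute.refl y).pow_left 2).zpow_right j)
  -- Otherwise `y`, a product of `t` and a power of `u`, centralises `T`, so `H` is abelian; but `A`
  -- lies in the kernel, so `H` maps onto S₃.
  have htT : ¬ ∀ τ ∈ T, t * τ = τ * t := by
    intro hall
    obtain ⟨q, hq⟩ := hmodd
    have hyt : y = t * (u ^ q)⁻¹ := by
      rw [eq_mul_inv_iff_mul_eq, ht, hu, ← pow_mul, hq, ← pow_succ']
    have hyT : ∀ τ ∈ T, Commute y τ := fun τ hτ => by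
      rw [hyt]
      exact Commute.mul_left (hall τ hτ) (((huT τ hτ).pow_left q).inv_left)
    have hTT : ∀ a ∈ T, ∀ b ∈ T, Commute a b := fun a ha b hb => by
      have := hTcyc.isMulCommutative
      exact congrArg Subtype.val (mul_comm' (⟨a, ha⟩ : T) ⟨b, hb⟩)
    have hHcomm : ∀ a b : H, Commute a b := fun a b => by
      obtain ⟨σ, hσ, i, rfl⟩ := hform a
      obtain ⟨τ, hτ, j, rfl⟩ := hform b
      exact Commute.mul_left
        ((hTT σ hσ τ hτ).mul_right ((hyT σ hσ).symm.zpow_right j))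
        (((hyT τ hτ).zpow_left i).mul_right (((Commute.refl y).zpow_left i).zpow_right j))
    have hHψ : ∀ p, ∃ h : H, ψ h = p := fun p => by
      obtain ⟨x, rfl⟩ := hψ p
      obtain ⟨⟨a, h⟩, rfl⟩ := hH.2 x
      exact ⟨h, by rw [map_mul, MonoidHom.mem_ker.1 (hAker a.2), one_mul]⟩
    apply perm_fin_three_not_commutative
    intro p q
    obtain ⟨a, rfl⟩ := hHψ p
    obtain ⟨b, rfl⟩ := hHψ q
    rw [← map_mul, ← map_mul]
    exact congrArg ψ (congrArg Subtype.val (hHcomm a b).eq)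
  have hinvert {τ : H} (hτ : τ ∈ T) : t * τ * t⁻¹ = τ⁻¹ :=
    Subgroup.conj_eq_inv_of_involution hTcyc hTcard htt htT hτ
  -- the dihedral subgroup
  set D := T ⊔ Subgroup.zpowers t with hD
  have htT2 : Disjoint T (Subgroup.zpowers t) := by
    apply Subgroup.disjoint_of_coprime_natCard
    rw [hTcard, Nat.card_zpowers, hto]
    exact Nat.Coprime.pow_left f (by norm_num)
  have hTD : (T.subgroupOf D).index = 2 := by
    change T.relIndex D = 2
    rw [hD, Subgroup.relIndex_sup_left, ← Subgroup.inf_relIndex_right, htT2.eq_bot,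
      Subgroup.relIndex_bot_left, Nat.card_zpowers, hto]
  let eT := Subgroup.subgroupOfEquivOfLe (le_sup_left : T ≤ D)
  have hTDcyc : IsCyclic (T.subgroupOf D) := isCyclic_of_surjective eT.symm eT.symm.surjective
  have hTDcard : Nat.card (T.subgroupOf D) = 3 ^ f := by
    rw [← hTcard]
    exact Nat.card_congr eT.toEquiv
  have hDinv : ∀ d ∉ T.subgroupOf D, d * d = 1 := by
    rintro ⟨d, hd⟩ hdT
    obtain ⟨τ, hτ, z, hz, rfl⟩ := Subgroup.mem_sup_of_normal_left.1 hd
    obtain ⟨j, rfl⟩ := Subgroup.mem_zpowers_iff.1 hz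
    have hdT' : τ * t ^ j ∉ T := hdT
    have ht2 : t ^ (2 : ℤ) = 1 := by rw [zpow_two, htt]
    have htj : t ^ j = t := by
      rcases Int.even_or_odd' j with ⟨i, rfl | rfl⟩
      · rw [zpow_mul, ht2, one_zpow, mul_one] at hdT'
        exact absurd hτ hdT'
      · rw [zpow_add, zpow_mul, ht2, one_zpow, zpow_one, one_mul]
    apply Subtype.ext
    change τ * t ^ j * (τ * t ^ j) = 1
    rw [htj]
    calc τ * t * (τ * t) = τ * (t * τ * t⁻¹) * (t * t) := by group
      _ = 1 := by rw [hinvert hτ, htt]; group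
  obtain ⟨φ⟩ := nonempty_mulEquiv_dihedralGroup hTDcyc hTD hDinv
  rw [hTDcard] at φ
  have hDcard : Nat.card D = 2 * 3 ^ f := by
    rw [Nat.card_congr φ.toEquiv, DihedralGroup.nat_card]
  set U := Subgroup.zpowers u with hU
  have hUcard : Nat.card U = m := by rw [hU, Nat.card_zpowers, huo]
  obtain ⟨ρ⟩ := IsCyclic.nonempty_mulEquiv_cyc (X := U) inferInstance
  rw [hUcard] at ρ
  obtain ⟨θ⟩ := Subgroup.nonempty_mulEquiv_prod (A := D) (B := U) (fun a _ b hb => by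
    obtain ⟨j, rfl⟩ := Subgroup.mem_zpowers_iff.1 hb
    exact ((hucent a).zpow_left j).eq.symm) (by
      apply Subgroup.disjoint_of_coprime_natCard
      rw [hDcard, hUcard]
      exact Nat.Coprime.mul_left hmodd.coprime_two_left (h3m.pow_left f))
    (by rw [hDcard, hUcard, hHcard, hm]; ring)
  refine ⟨A, H, hAn, inferInstance, hAker, hH, f, m, hf, ?_, ?_, ⟨θ.trans (φ.prodCongr ρ)⟩⟩
  · rw [hAcard]
    exact (hni.coprime_dvd_right ⟨2, by rw [hm, mul_comm]⟩).symm
  · rw [hAcard]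
    exact hmodd.mul hnodd

/-! ### Sylow 2-subgroups, actions and complements of a moved four-group -/

namespace Subgroup

variable {G : Type*} [Group G] [Finite G] {V : Subgroup G}

theorem IsMovedKlein.le_centralizer (hV : V.IsMovedKlein) : V ≤ centralizer (V : Set G) := by
  have := hV.isKleinFour
  have := IsKleinFour.isMulCommutative (G := V)
  intro v hv
  rw [mem_centralizer_iff]
  intro w hw
  exact congrArg Subtype.val (mul_comm' (⟨w, hw⟩ : V) ⟨v, hv⟩)

/-- A Sylow `2`-subgroup above a normal four-group has order at most eight. -/
theorem IsMovedKlein.card_sylow (hV : V.IsMovedKlein) {S : Subgroup G} (hVS : V ≤ S)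
    (hS : IsDihedralType S) :
    Nat.card S = 4 ∨ Nat.card S = 8 ∧ ∃ s ∈ S, s ∉ centralizer (V : Set G) := by
  obtain ⟨C, hC, hi, hinv⟩ := hS
  have hK := hV.isKleinFour
  have hcomm := hV.le_centralizer
  have hsq : ∀ w ∈ V, w * w = 1 := fun w hw =>
    congrArg Subtype.val (IsKleinFour.mul_self (⟨w, hw⟩ : V))
  obtain ⟨v, hv, hvC⟩ : ∃ v, ∃ hv : v ∈ V, (⟨v, hVS hv⟩ : S) ∉ C := by
    by_contra! h
    refine hV.not_isCyclic (isCyclic_of_injective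
      ((inclusion hVS).codRestrict C fun v => h v v.2) fun a b hab => ?_)
    exact Subtype.ext (congrArg (fun c : C => ((c : S) : G)) hab)
  have hi2 : C.index = 2 := by
    rcases (Nat.dvd_prime Nat.prime_two).1 hi with h | h
    · rw [Subgroup.index_eq_one] at h
      exact absurd (h ▸ mem_top _) hvC
    · exact h
  obtain ⟨⟨⟨c, hcS⟩, hc⟩, hgen⟩ := hC.exists_generator
  have hoc : orderOf c = Nat.card C := by
    rw [← orderOf_eq_card_of_forall_mem_zpowers hgen, Subgroup.orderOf_mk, Subgroup.orderOf_mk]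
  have hvc : v * c * (v * c) = 1 := by
    have := hinv (⟨v, hVS hv⟩ * ⟨c, hcS⟩) fun h => hvC ((C.mul_mem_cancel_right hc).1 h)
    exact congrArg Subtype.val this
  have hvv := hsq v hv
  have hv1 : v⁻¹ = v := inv_eq_of_mul_eq_one_left hvv
  have hcv : c * v * c⁻¹ = c ^ 2 * v := by
    have h1 : v * c⁻¹ = c * v := by
      rw [mul_inv_eq_iff_eq_mul]
      calc v = v⁻¹ := hv1.symm
        _ = c * v * c := inv_eq_of_mul_eq_one_right (by simpa [mul_assoc] using hvc)
    rw [mul_assoc, h1, ← mul_assoc, pow_two]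
  -- `v` inverts `c`, so c² is the commutator of `c` and `v` and lies in the normal subgroup `V`,
  -- which has exponent 2.
  have hc2 : c ^ 2 ∈ V := by
    have := hV.1.conj_mem v hv c
    rw [hcv] at this
    exact (V.mul_mem_cancel_right hv).1 this
  have hc4 : c ^ 4 = 1 := by
    have := hsq _ hc2
    rwa [← pow_add] at this
  have hdvd : Nat.card C ∣ 4 := hoc ▸ orderOf_dvd_of_pow_eq_one hc4
  have hcard : Nat.card S = Nat.card C * 2 := by rw [← hi2, C.card_mul_index]
  have h4S : 4 ∣ Nat.card S := hV.2.1 ▸ card_dvd_of_le hVS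
  by_cases h4 : Nat.card C = 4
  · refine Or.inr ⟨by omega, c, hcS, fun hcent => ?_⟩
    have h2 := mem_centralizer_iff.1 hcent v hv
    have h3 : c ^ 2 = 1 := by
      rw [← h2, mul_inv_cancel_right] at hcv
      simpa using hcv
    have := Nat.le_of_dvd two_pos (orderOf_dvd_of_pow_eq_one h3)
    omega
  · left
    have h5 := Nat.le_of_dvd four_pos hdvd
    have h6 : 0 < Nat.card C := Nat.card_pos
    generalize Nat.card C = k at *
    interval_cases k <;> omega

/-- The action on the three involutions of a normal four-group. -/
theorem IsMovedKlein.exists_hom (hV : V.IsMovedKlein) :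
    ∃ ψ : G →* Equiv.Perm (Fin 3), ψ.ker = centralizer (V : Set G) := by
  have hn := hV.1
  let f : MulAut V →* Equiv.Perm {v : V // v ≠ 1} := MonoidHom.mk'
    (fun e => Equiv.Perm.subtypePerm e.toEquiv fun x => by simp) fun a b => rfl
  have hcard : Nat.card {v : V // v ≠ 1} = 3 := by
    have := Fintype.ofFinite V
    classical
    rw [Nat.card_eq_fintype_card, Fintype.card_subtype_compl (fun v : V => v = 1),
      Fintype.card_subtype_eq, ← Nat.card_eq_fintype_card, hV.2.1]
  let e : {v : V // v ≠ 1} ≃ Fin 3 := Nat.equivFinOfCardPos (by omega) |>.trans (finCongr hcard)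
  refine ⟨e.permCongrHom.toMonoidHom.comp (f.comp MulAut.conjNormal), ?_⟩
  ext g
  rw [MonoidHom.mem_ker, mem_centralizer_iff]
  change e.permCongrHom (f (MulAut.conjNormal g)) = 1 ↔ _
  rw [map_eq_one_iff _ e.permCongrHom.injective]
  constructor
  · intro h v hv
    by_cases hv1 : v = 1
    · simp [hv1]
    have h1 := DFunLike.congr_fun h ⟨⟨v, hv⟩, fun h => hv1 (congrArg Subtype.val h)⟩
    have h2 := congrArg (fun x : {v : V // v ≠ 1} => ((x : V) : G)) h1
    change g * v * g⁻¹ = v at h2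
    exact (mul_inv_eq_iff_eq_mul.1 h2).symm
  · intro h
    ext v
    change g * v * g⁻¹ = v
    rw [mul_inv_eq_iff_eq_mul]
    exact (h v v.1.2).symm

theorem IsMovedKlein.index_centralizer_dvd (hV : V.IsMovedKlein) :
    (centralizer (V : Set G)).index ∣ 6 := by
  obtain ⟨ψ, hψ⟩ := hV.exists_hom
  have h6 : Nat.card (Equiv.Perm (Fin 3)) = 6 := by
    rw [Nat.card_eq_fintype_card, Fintype.card_perm]; rfl
  rw [← hψ, index_ker, ← h6]
  exact card_subgroup_dvd_card _

/-- Otherwise the index divides 2, and an element of odd order could not move `V`. -/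
theorem IsMovedKlein.three_dvd_index_centralizer (hV : V.IsMovedKlein) :
    3 ∣ (centralizer (V : Set G)).index := by
  have hdvd := hV.index_centralizer_dvd
  obtain ⟨hn, -, x, hodd, hx⟩ := id hV
  by_contra h3
  refine hx (mem_of_coprime_index _ ?_)
  have h2 : (centralizer (V : Set G)).index ∣ 2 :=
    Nat.Coprime.dvd_of_dvd_mul_left
      (Nat.coprime_comm.1 ((Nat.Prime.coprime_iff_not_dvd Nat.prime_three).2 h3)) (n := 2) (m := 3)
      (by simpa using hdvd)
  exact hodd.coprime_two_right.coprime_dvd_right h2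

end Subgroup

namespace Subgroup

variable {G : Type*} [Group G] [Finite G] {V K : Subgroup G}

/-- A complement of `V` in `G`, together with a decomposition of that complement, decomposes `G`. -/
theorem IsMovedKlein.isSplitExtension (hV : V.IsMovedKlein) (hK : V.IsComplement' K)
    {A H : Subgroup K} [A.Normal] (hA : IsCyclic A)
    (hAV : A.map K.subtype ≤ centralizer (V : Set G)) (hH : A.IsComplement' H)
    {X : Type*} [Group X] (e : H ≃* X) :
    IsSplitExtension G (Cyc (Nat.card A) × DihedralGroup 2) X := by
  have hn := hV.1
  have hKF := hV.isKleinFour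
  set B := A.map K.subtype with hB
  have hBcard : Nat.card B = Nat.card A := card_map_of_injective K.subtype_injective
  have hBcyc : IsCyclic B := isCyclic_of_surjective _ (K.subtype.subgroupMap_surjective A)
  have hBK : B ≤ K := map_subtype_le A
  have hprod : ∀ g : G, ∃ v ∈ V, ∃ k : K, v * k = g := fun g => by
    obtain ⟨⟨v, k⟩, h⟩ := hK.2 g
    exact ⟨v, v.2, k, h⟩
  have hdisj : Disjoint B V := hK.disjoint.symm.mono_left hBK
  set N := V ⊔ B with hN
  -- `B` is normalised by `K`, and conjugation by elements of `V` stays inside `N`.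
  have hNn : N.Normal := by
    refine ⟨fun x hx g => ?_⟩
    obtain ⟨w, hw, b, hb, rfl⟩ := mem_sup_of_normal_left.1 hx
    obtain ⟨v, hv, k, rfl⟩ := hprod g
    obtain ⟨a, ha, rfl⟩ := hb
    have h1 : v * k * w * (v * k)⁻¹ ∈ N := (le_sup_left : V ≤ N) (hn.conj_mem w hw _)
    have h2 : k * (a : G) * (k : G)⁻¹ ∈ B :=
      ⟨k * a * k⁻¹, Normal.conj_mem inferInstance a ha k, rfl⟩
    have h3 : v * k * a * (v * k)⁻¹ ∈ N := by
      have hvN : v ∈ N := (le_sup_left : V ≤ N) hv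
      have := mul_mem (mul_mem hvN ((le_sup_right : B ≤ N) h2)) (inv_mem hvN)
      convert this using 1
      group
    have := mul_mem h1 h3
    convert this using 1
    simp only [subtype_apply]
    group
  let H' := H.map K.subtype
  have hH'K : H' ≤ K := map_subtype_le H
  have hH'card : Nat.card H' = Nat.card H := card_map_of_injective K.subtype_injective
  have hcommBV : ∀ b ∈ B, ∀ v ∈ V, b * v = v * b := fun b hb v hv =>
    (mem_centralizer_iff.1 (hAV hb) v hv).symm
  obtain ⟨θ⟩ := nonempty_mulEquiv_prod (X := N) (A := B.subgroupOf N) (B := V.subgroupOf N)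
    (fun b hb v hv => Subtype.ext (hcommBV b hb v hv))
    (by
      rw [disjoint_def]
      intro x hx hx'
      exact Subtype.ext (disjoint_def.1 hdisj hx hx'))
    (by
      have h1 := (V.subgroupOf N).card_mul_index
      have h2 : (V.subgroupOf N).index = Nat.card B := by
        change V.relIndex N = _
        rw [hN, relIndex_sup_left, ← inf_relIndex_right, inf_comm, hdisj.eq_bot, relIndex_bot_left]
      rw [h2] at h1
      rw [Nat.card_congr (subgroupOfEquivOfLe (le_sup_right : B ≤ N)).toEquiv, mul_comm, h1])
  have hNcard : Nat.card N = Nat.card A * 4 := by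
    rw [Nat.card_congr θ.toEquiv, Nat.card_prod,
      Nat.card_congr (subgroupOfEquivOfLe (le_sup_right : B ≤ N)).toEquiv,
      Nat.card_congr (subgroupOfEquivOfLe (le_sup_left : V ≤ N)).toEquiv, hV.2.1, hBcard]
  obtain ⟨φ⟩ := hBcyc.nonempty_mulEquiv_cyc
  rw [hBcard] at φ
  obtain ⟨ρ⟩ := IsKleinFour.nonempty_mulEquiv (G₁ := V) (G₂ := DihedralGroup 2)
  refine ⟨N, H', hNn, ?_, ⟨θ.trans (((subgroupOfEquivOfLe le_sup_right).trans φ).prodCongr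
    ((subgroupOfEquivOfLe le_sup_left).trans ρ))⟩,
    ⟨(H.equivMapOfInjective K.subtype K.subtype_injective).symm.trans e⟩⟩
  refine isComplement'_of_card_mul_and_disjoint ?_ ?_
  · rw [hNcard, hH'card, ← hK.card_mul_card, hV.2.1, ← hH.card_mul_card]
    ring
  · rw [disjoint_def]
    rintro x hx ⟨h, hh, rfl⟩
    obtain ⟨v, hv, b, hb, hvb⟩ := mem_sup_of_normal_left.1 hx
    have hvK : v ∈ K := by
      have : v = K.subtype h * b⁻¹ := by rw [← hvb]; group
      rw [this]
      exact mul_mem h.2 (inv_mem (hBK hb))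
    have hv1 : v = 1 := disjoint_def.1 hK.disjoint hv hvK
    rw [hv1, one_mul] at hvb
    obtain ⟨a, ha, rfl⟩ := hb
    have hah : a = h := K.subtype_injective hvb
    rw [disjoint_def.1 hH.disjoint ha (hah ▸ hh)] at hah
    rw [← hah]
    rfl

/-- The action on the cosets of a complement of the four-group. -/
theorem IsMovedKlein.exists_hom_perm_four (hV : V.IsMovedKlein) (hK : V.IsComplement' K) :
    ∃ φ : G →* Equiv.Perm (Fin 4), 4 * (centralizer (V : Set G)).index ∣ Nat.card φ.range := by
  have hn := hV.1
  have hcard : Nat.card (G ⧸ K) = 4 := by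
    rw [← hV.2.1, ← hK.index_eq_card]
    rfl
  let e : (G ⧸ K) ≃ Fin 4 := (Nat.equivFinOfCardPos (by omega)).trans (finCongr hcard)
  let φ : G →* Equiv.Perm (Fin 4) :=
    e.permCongrHom.toMonoidHom.comp (MulAction.toPermHom G (G ⧸ K))
  refine ⟨φ, ?_⟩
  have hker : φ.ker ≤ K := by
    intro g hg
    have h1 : MulAction.toPermHom G (G ⧸ K) g = 1 :=
      (map_eq_one_iff _ e.permCongrHom.injective).1 hg
    have h2 := DFunLike.congr_fun h1 ((1 : G) : G ⧸ K)
    change ((g * 1 : G) : G ⧸ K) = ((1 : G) : G ⧸ K) at h2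
    rw [mul_one, eq_comm, QuotientGroup.eq] at h2
    simpa using h2
  -- The kernel meets `V` trivially. Both are normal, so they commute; hence the kernel lies in the
  -- centraliser of `V`, and `V` embeds in its image.
  have hdisj : Disjoint V φ.ker := hK.disjoint.mono_right hker
  have hcent : φ.ker ≤ centralizer (V : Set G) := by
    intro g hg
    rw [mem_centralizer_iff]
    intro v hv
    exact commute_of_normal_of_disjoint V φ.ker hn inferInstance hdisj v g hv hg
  have h4 : Nat.card (V.map φ) = 4 := by
    rw [← relIndex_ker, ← inf_relIndex_right, inf_comm, hdisj.eq_bot, relIndex_bot_left, hV.2.1]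
  rw [← index_ker, ← relIndex_mul_index hcent]
  refine Nat.mul_dvd_mul_right ?_ _
  rw [relIndex_ker]
  exact h4.symm.dvd.trans (card_dvd_of_le (map_mono hV.le_centralizer))

end Subgroup

/-! ### The cases of A₄ and S₄ -/

namespace Subgroup

variable {G : Type*} [Group G] [Finite G] {V K : Subgroup G}

theorem IsMovedKlein.surjective_of_six (hV : V.IsMovedKlein) (hK : V.IsComplement' K)
    (h6 : (centralizer (V : Set G)).index = 6) :
    ∃ φ : G →* Equiv.Perm (Fin 4), Function.Surjective φ := by
  obtain ⟨φ, hφ⟩ := hV.exists_hom_perm_four hK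
  have h24 : Nat.card (Equiv.Perm (Fin 4)) = 24 := by
    rw [Nat.card_eq_fintype_card, Fintype.card_perm]; rfl
  refine ⟨φ, MonoidHom.range_eq_top.1 (eq_top_of_le_card _ ?_)⟩
  rw [h24]
  rw [h6] at hφ
  exact Nat.le_of_dvd Nat.card_pos hφ

theorem IsMovedKlein.surjective_of_three (hV : V.IsMovedKlein) (hK : V.IsComplement' K)
    (hodd : Odd (Nat.card K)) (h3 : (centralizer (V : Set G)).index = 3) :
    ∃ φ : G →* alternatingGroup (Fin 4), Function.Surjective φ := by
  obtain ⟨φ, hφ⟩ := hV.exists_hom_perm_four hK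
  have h24 : Nat.card (Equiv.Perm (Fin 4)) = 24 := by
    rw [Nat.card_eq_fintype_card, Fintype.card_perm]; rfl
  have hmul := φ.range.card_mul_index
  rw [h24] at hmul
  obtain ⟨j, hj⟩ := hφ
  rw [h3] at hj
  rw [hj, mul_assoc, mul_assoc] at hmul
  have hji : j * φ.range.index = 2 := by omega
  -- The image has order 12j with j dividing 2; an image of order 24 is impossible because |G| is 4
  -- times an odd number.
  have hj2 : ¬ 2 ∣ j := by
    rintro ⟨i, rfl⟩
    have h1 : Nat.card φ.range ∣ Nat.card G := card_range_dvd φ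
    rw [← hK.card_mul_card, hV.2.1, hj] at h1
    have h2 : 2 * (3 * i) ∣ Nat.card K := by
      refine Nat.dvd_of_mul_dvd_mul_left four_pos ?_
      convert h1 using 1
      ring
    exact hodd.not_two_dvd_nat ((Dvd.intro _ rfl).trans h2)
  have hi : φ.range.index = 2 := by
    have h1 : j ∣ 2 := ⟨_, hji.symm⟩
    rcases (Nat.dvd_prime Nat.prime_two).1 h1 with rfl | rfl
    · simpa using hji
    · exact absurd dvd_rfl hj2
  have hr := Equiv.Perm.eq_alternatingGroup_of_index_eq_two hi
  exact ⟨(MulEquiv.subgroupCongr hr).toMonoidHom.comp φ.rangeRestrict,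
    (MulEquiv.subgroupCongr hr).surjective.comp φ.rangeRestrict_surjective⟩

theorem isZGroup_of_card_dvd_two_mul {Q : Type*} [Group Q] [Finite Q]
    (hQ : HasDihedralTypeSylows Q) {k : ℕ} (hk : Odd k) (hcard : Nat.card Q = 2 * k) :
    IsZGroup Q := by
  refine ⟨fun p hp P => ?_⟩
  rcases eq_or_ne p 2 with rfl | hp2
  · have : Fact (Nat.Prime 2) := ⟨Nat.prime_two⟩
    obtain ⟨j, hj⟩ := IsPGroup.iff_card.1 P.2
    refine isCyclic_of_card_le_three ?_
    have h1 : 2 ^ j ∣ 2 * k := by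
      rw [← hj, ← hcard]
      exact card_subgroup_dvd_card _
    have h2 : 2 ^ j ∣ 2 :=
      (Nat.Coprime.pow_left j hk.coprime_two_left).dvd_of_dvd_mul_right h1
    have h3 := Nat.le_of_dvd two_pos h2
    change Nat.card (P : Subgroup Q) ≤ 3
    omega
  · exact hQ.isCyclic hp hp2 P.2

theorem IsMovedKlein.three_case (hV : V.IsMovedKlein) (hG : HasDihedralTypeSylows G)
    (hodd : Odd V.index) :
    ∃ n m : ℕ, Nat.gcd m n = 1 ∧ Odd (m * n) ∧ 3 ∣ m ∧
      IsSplitExtension G (Cyc n × DihedralGroup 2) (Cyc m) ∧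
      ∃ φ : G →* alternatingGroup (Fin 4), Function.Surjective φ := by
  have hn := hV.1
  obtain ⟨K, hK⟩ := exists_right_complement'_of_coprime (N := V) (by
    rw [hV.2.1]
    exact Nat.Coprime.pow_left 2 hodd.coprime_two_left)
  have hKodd : Odd (Nat.card K) := by rwa [← hK.symm.index_eq_card]
  have hKZ : IsZGroup K :=
    (hG.of_injective K.subtype K.subtype_injective).isZGroup_of_odd hKodd
  set D := centralizer (V : Set G) with hD
  have hVD : V ≤ D := hV.le_centralizer
  have hD3 : D.index = 3 := by
    have h1 : Odd D.index := hodd.of_dvd_nat (index_dvd_of_le hVD)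
    have h2 : D.index ∣ 3 := h1.coprime_two_right.dvd_of_dvd_mul_left
      (hV.index_centralizer_dvd.trans (by norm_num : 6 ∣ 2 * 3))
    exact Nat.dvd_antisymm h2 hV.three_dvd_index_centralizer
  have hDK : (D.subgroupOf K).index = 3 := by
    have h1 : K ⊔ D = ⊤ := by
      rw [eq_top_iff, ← hK.sup_eq_top, sup_comm V]
      exact sup_le_sup_left hVD K
    rw [← hD3]
    change D.relIndex K = _
    rw [← relIndex_sup_right, h1, relIndex_top_right]
  -- `K` induces on `V` a group of order 3, which is abelian, so K' centralises `V`.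
  have hKD : _root_.commutator K ≤ D.subgroupOf K := by
    have h1 : IsCyclic (K ⧸ D.subgroupOf K) := isCyclic_of_prime_card (p := 3) hDK
    have := h1.isMulCommutative
    rw [_root_.commutator_def, commutator_le]
    intro a _ b _
    rw [← QuotientGroup.eq_one_iff]
    change ((a * b * a⁻¹ * b⁻¹ : K) : K ⧸ D.subgroupOf K) = 1
    rw [QuotientGroup.mk_mul, QuotientGroup.mk_mul, QuotientGroup.mk_mul,
      mul_comm' (a : K ⧸ D.subgroupOf K) b]
    simp
  have hcop := IsZGroup.coprime_commutator_index K
  obtain ⟨H, hH⟩ := exists_right_complement'_of_coprime hcop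
  have hHc : IsCyclic H := by
    have h1 : Abelianization K ≃* H := hH.symm.QuotientMulEquiv
    exact isCyclic_of_surjective _ h1.surjective
  obtain ⟨e⟩ := hHc.nonempty_mulEquiv_cyc
  have hHcard : Nat.card H = (_root_.commutator K).index := hH.symm.index_eq_card.symm
  refine ⟨Nat.card (_root_.commutator K), Nat.card H, ?_, ?_, ?_,
    hV.isSplitExtension hK (IsZGroup.isCyclic_commutator K) (map_le_iff_le_comap.2 hKD) hH e,
    hV.surjective_of_three hK hKodd hD3⟩
  · rw [hHcard]
    exact hcop.symm
  · rwa [mul_comm, hH.card_mul_card]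
  · rw [hHcard, ← hDK]
    exact index_dvd_of_le hKD

theorem IsMovedKlein.six_case (hV : V.IsMovedKlein) (hG : HasDihedralTypeSylows G)
    {k : ℕ} (hk : Odd k) (hVk : V.index = 2 * k) (h2 : 2 ∣ (centralizer (V : Set G)).index) :
    ∃ n m f : ℕ, 1 ≤ f ∧ Nat.gcd m n = 1 ∧ Odd (m * n) ∧
      IsSplitExtension G (Cyc n × DihedralGroup 2) (DihedralGroup (3 ^ f) × Cyc m) ∧
      ∃ φ : G →* Equiv.Perm (Fin 4), Function.Surjective φ := by
  have hn := hV.1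
  have : Fact (Nat.Prime 3) := ⟨Nat.prime_three⟩
  have h6 : (centralizer (V : Set G)).index = 6 :=
    Nat.dvd_antisymm hV.index_centralizer_dvd
      (Nat.Coprime.mul_dvd_of_dvd_of_dvd (by norm_num : Nat.Coprime 2 3) h2
        hV.three_dvd_index_centralizer)
  have hVD := hV.le_centralizer
  obtain ⟨ψ, hψ⟩ := hV.exists_hom
  have hψs : Function.Surjective ψ := by
    refine MonoidHom.range_eq_top.1 (eq_top_of_card_eq _ ?_)
    rw [← index_ker, hψ, h6, Nat.card_eq_fintype_card, Fintype.card_perm]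
    rfl
  -- the quotient
  have hQcard : Nat.card (G ⧸ V) = 2 * k := hVk
  have hsurj := QuotientGroup.mk'_surjective V
  have hQZ : IsZGroup (G ⧸ V) :=
    isZGroup_of_card_dvd_two_mul (hG.of_surjective _ hsurj) hk hQcard
  let ψQ : G ⧸ V →* Equiv.Perm (Fin 3) := QuotientGroup.lift V ψ (hVD.trans hψ.ge)
  have hψQ : Function.Surjective ψQ := fun p => by
    obtain ⟨g, rfl⟩ := hψs p
    exact ⟨g, rfl⟩
  let T : Sylow 3 G := default
  have hTn := sylow_three_normal ψQ hψQ (T.mapSurjective hsurj)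
  rw [Sylow.coe_mapSurjective] at hTn
  have hTV : ((T : Subgroup G) ⊔ V).Normal := by
    have : (((T : Subgroup G).map (QuotientGroup.mk' V)).comap (QuotientGroup.mk' V)).Normal :=
      hTn.comap _
    rwa [comap_map_eq, QuotientGroup.ker_mk'] at this
  -- Modulo `V` the Sylow 3-subgroup becomes normal, so `TV` is normal in `G` and the Frattini
  -- argument gives G = N(T)V.
  set K := normalizer ((T : Subgroup G) : Set G) with hKdef
  have hfr : K ⊔ V = ⊤ := by
    have h1 := T.normalizer_sup_eq_top' (N := (T : Subgroup G) ⊔ V) le_sup_left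
    rw [← sup_assoc] at h1
    change K ⊔ (T : Subgroup G) ⊔ V = ⊤ at h1
    have hTK : (T : Subgroup G) ≤ K := le_normalizer
    rwa [sup_eq_left.2 hTK] at h1
  have hTodd : ∀ t ∈ T, Odd (orderOf t) := fun t ht => by
    obtain ⟨j, hj⟩ := IsPGroup.iff_orderOf.1 T.2 ⟨t, ht⟩
    rw [Subgroup.orderOf_mk] at hj
    rw [hj]
    exact Odd.pow (by decide)
  obtain ⟨t, htT, htV⟩ : ∃ t ∈ T, t ∉ centralizer (V : Set G) := by
    by_contra! h
    refine T.not_dvd_index (Dvd.dvd.trans ?_ (index_dvd_of_le h))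
    exact hV.three_dvd_index_centralizer
  have hdisjVT : Disjoint V (T : Subgroup G) := by
    apply disjoint_of_coprime_natCard
    obtain ⟨j, hj⟩ := IsPGroup.iff_card.1 T.2
    rw [hV.2.1]
    rw [hj]
    exact Nat.Coprime.pow_right j (by norm_num)
  -- If `v` in `V` normalises `T`, then [v, t] lies in V ∩ T = 1, so `t` fixes `v`; but `t` has odd
  -- order and moves `V`, so v = 1.
  have hdisj : Disjoint V K := by
    rw [disjoint_def]
    intro v hv hvK
    by_contra hv1
    refine htV (hV.mem_centralizer (hTodd t htT) hv hv1 ?_)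
    have h1 : v * t * v⁻¹ * t⁻¹ ∈ (T : Subgroup G) :=
      mul_mem ((mem_normalizer_iff.1 hvK t).1 htT) (inv_mem htT)
    have h2 : v * t * v⁻¹ * t⁻¹ ∈ V := by
      have := V.mul_mem hv (hn.conj_mem _ (V.inv_mem hv) t)
      rwa [← mul_assoc, ← mul_assoc] at this
    have h3 := disjoint_def.1 hdisjVT h2 h1
    rw [mul_inv_eq_one, mul_inv_eq_iff_eq_mul] at h3
    exact h3.symm
  have hK : V.IsComplement' K := by
    refine isComplement'_of_disjoint_and_mul_eq_univ hdisj ?_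
    rw [← normal_mul, sup_comm, hfr, coe_top]
  have hKcard : Nat.card K = 2 * k := by rw [← hVk, hK.symm.index_eq_card]
  have hKZ : IsZGroup K :=
    isZGroup_of_card_dvd_two_mul (hG.of_injective K.subtype K.subtype_injective) hk hKcard
  have hψK : Function.Surjective (ψ.comp K.subtype) := fun p => by
    obtain ⟨g, rfl⟩ := hψs p
    obtain ⟨⟨v, x⟩, rfl⟩ := hK.2 g
    have hv : ψ v = 1 := by
      rw [← MonoidHom.mem_ker, hψ]
      exact hVD v.2
    exact ⟨x, by rw [map_mul, hv, one_mul]; rfl⟩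
  obtain ⟨A, H, hAn, hAc, hAker, hH, f, m, hf, hmn, hodd, ⟨e⟩⟩ :=
    IsZGroup.exists_complement_dihedralGroup hKcard hk (ψ.comp K.subtype) hψK
  have hAV : A.map K.subtype ≤ centralizer (V : Set G) := by
    rw [← hψ, map_le_iff_le_comap]
    exact hAker
  exact ⟨Nat.card A, m, f, hf, hmn, hodd, hV.isSplitExtension hK hAc hAV hH e,
    hV.surjective_of_six hK h6⟩

end Subgroup

/-! ### From maps to Sylow subgroups of dihedral type -/

theorem Subgroup.exists_zpow_of_mem_closure_pair {X : Type*} [Group X] {a b h : X}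
    (ha : a * a = 1) (hb : b * b = 1) (hh : h ∈ Subgroup.closure {a, b}) :
    ∃ k : ℤ, h = (a * b) ^ k ∨ h = (a * b) ^ k * b := by
  have hconj (k : ℤ) : b * (a * b) ^ k = (a * b) ^ (-k) * b := by
    have hb' : b⁻¹ = b := inv_eq_of_mul_eq_one_left hb
    have ha' : a⁻¹ = a := inv_eq_of_mul_eq_one_left ha
    rw [← mul_inv_eq_iff_eq_mul, ← conj_zpow, zpow_neg, ← inv_zpow]
    congr 1
    rw [mul_inv_rev, ha', hb']
    calc b * (a * b) * b = b * a * (b * b) := by group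
      _ = b * a := by rw [hb, mul_one]
  induction hh using Subgroup.closure_induction with
  | mem y hy =>
    rcases hy with rfl | rfl
    · exact ⟨1, Or.inr (by rw [zpow_one, mul_assoc, hb, mul_one])⟩
    · exact ⟨0, Or.inr (by simp)⟩
  | one => exact ⟨0, Or.inl (by simp)⟩
  | mul y z _ _ hy hz =>
    obtain ⟨k, rfl | rfl⟩ := hy <;> obtain ⟨l, rfl | rfl⟩ := hz
    · exact ⟨k + l, Or.inl (by rw [zpow_add])⟩
    · exact ⟨k + l, Or.inr (by rw [zpow_add, mul_assoc])⟩
    · exact ⟨k + -l, Or.inr (by rw [mul_assoc, hconj, ← mul_assoc, zpow_add])⟩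
    · refine ⟨k + -l, Or.inl ?_⟩
      rw [mul_assoc, ← mul_assoc b, hconj, mul_assoc _ b b, hb, mul_one, zpow_add]
  | inv y _ hy =>
    obtain ⟨k, rfl | rfl⟩ := hy
    · exact ⟨-k, Or.inl (by rw [zpow_neg])⟩
    · refine ⟨k, Or.inr ?_⟩
      rw [mul_inv_rev, inv_eq_of_mul_eq_one_left hb, ← zpow_neg, hconj, neg_neg]

/-- A group acting freely and commuting with two involutions whose dihedral group moves a point to
all points of its orbit. -/
theorem isDihedralType_of_free {Ω P : Type*} [Group P] (ι : P →* Equiv.Perm Ω)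
    {a b : Equiv.Perm Ω} (ha : a * a = 1) (hb : b * b = 1) (hca : ∀ g, Commute (ι g) a)
    (hcb : ∀ g, Commute (ι g) b) (x : Ω) (hfree : ∀ g, ι g x = x → g = 1)
    (horb : ∀ g, ∃ h ∈ Subgroup.closure {a, b}, ι g x = h x) : IsDihedralType P := by
  set ρ := a * b with hρ
  have hcρ (g : P) (k : ℤ) : Commute (ι g) (ρ ^ k) := ((hca g).mul_right (hcb g)).zpow_right k
  have horb' (g : P) : ∃ k : ℤ, ι g x = (ρ ^ k) x ∨ ι g x = (ρ ^ k * b) x := by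
    obtain ⟨h, hh, hg⟩ := horb g
    obtain ⟨k, rfl | rfl⟩ := Subgroup.exists_zpow_of_mem_closure_pair ha hb hh
    · exact ⟨k, Or.inl hg⟩
    · exact ⟨k, Or.inr hg⟩
  have hinj {g h : P} (hgh : ι g x = ι h x) : g = h := by
    refine inv_mul_eq_one.1 (hfree _ ?_) |>.symm
    rw [map_mul, map_inv, Equiv.Perm.mul_apply, Equiv.Perm.inv_eq_iff_eq, hgh]
  -- The actions of `P` and of the dihedral group commute, so the representatives `u` and `v`
  -- multiply in reverse order.
  have hmul {g h : P} {u v : Equiv.Perm Ω} (hg : ι g x = u x) (hh : ι h x = v x)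
      (hc : Commute (ι g) v) : ι (g * h) x = (v * u) x := by
    rw [map_mul, Equiv.Perm.mul_apply, hh, ← Equiv.Perm.mul_apply, hc.eq, Equiv.Perm.mul_apply, hg,
      Equiv.Perm.mul_apply]
  have hsq (k l : ℤ) : ρ ^ l * b * (ρ ^ k * b) = ρ ^ (l - k) := by
    have hmem : ρ ^ k * b * (ρ ^ k * b) = 1 := by
      have hb' : b⁻¹ = b := inv_eq_of_mul_eq_one_left hb
      have ha' : a⁻¹ = a := inv_eq_of_mul_eq_one_left ha
      have h1 : b * ρ * b⁻¹ = ρ⁻¹ := by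
        rw [hρ, mul_inv_rev, ha', hb', mul_assoc, mul_assoc, hb, mul_one]
      have h2 : b * ρ ^ k * b⁻¹ = (ρ ^ k)⁻¹ := by rw [← conj_zpow, h1, inv_zpow]
      rw [hb'] at h2
      rw [mul_assoc, ← mul_assoc b, h2, mul_inv_cancel]
    have h3 : ρ ^ l * b = ρ ^ (l - k) * (ρ ^ k * b) := by
      rw [← mul_assoc, ← zpow_add, sub_add_cancel]
    rw [h3, mul_assoc, hmem, mul_one]
  -- `C` consists of the elements that move `x` as a rotation does; all others move it as a
  -- reflection does.
  let C : Subgroup P :=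
    { carrier := {g | ∃ k : ℤ, ι g x = (ρ ^ k) x}
      one_mem' := ⟨0, by simp⟩
      mul_mem' := by
        rintro g h ⟨k, hk⟩ ⟨l, hl⟩
        exact ⟨l + k, by rw [hmul hk hl (hcρ g l), zpow_add]⟩
      inv_mem' := by
        rintro g ⟨k, hk⟩
        refine ⟨-k, ?_⟩
        rw [map_inv, Equiv.Perm.inv_eq_iff_eq, ← Equiv.Perm.mul_apply, (hcρ g (-k)).eq,
          Equiv.Perm.mul_apply, hk, ← Equiv.Perm.mul_apply, ← zpow_add]
        simp }
  have hout {g : P} (hg : g ∉ C) : ∃ k : ℤ, ι g x = (ρ ^ k * b) x := by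
    obtain ⟨k, h | h⟩ := horb' g
    · exact absurd ⟨k, h⟩ hg
    · exact ⟨k, h⟩
  have houtmul {g h : P} {k l : ℤ} (hg : ι g x = (ρ ^ k * b) x) (hh : ι h x = (ρ ^ l * b) x) :
      ι (g * h) x = (ρ ^ (l - k)) x := by
    rw [hmul hg hh ((hcρ g l).mul_right (hcb g)), hsq]
  refine ⟨C, ?_, ?_, fun g hg => ?_⟩
  -- The exponents of the rotations realised by `P` form a subgroup dℤ, and by freeness an element
  -- realising the exponent `d` generates `C`.
  · let L : AddSubgroup ℤ :=
      { carrier := {k | ∃ g, ι g x = (ρ ^ k) x}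
        zero_mem' := ⟨1, by simp⟩
        add_mem' := by
          rintro k l ⟨g, hg⟩ ⟨h, hh⟩
          exact ⟨h * g, by rw [hmul hh hg (hcρ h k), zpow_add]⟩
        neg_mem' := by
          rintro k ⟨g, hg⟩
          have hgC : g ∈ C := ⟨k, hg⟩
          refine ⟨g⁻¹, ?_⟩
          rw [map_inv, Equiv.Perm.inv_eq_iff_eq, ← Equiv.Perm.mul_apply, (hcρ g (-k)).eq,
            Equiv.Perm.mul_apply, hg, ← Equiv.Perm.mul_apply, ← zpow_add]
          simp }
    obtain ⟨d, hd⟩ := Int.subgroup_cyclic L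
    have hdL : d ∈ L := by
      rw [hd]
      exact AddSubgroup.subset_closure rfl
    obtain ⟨r, hr⟩ := hdL
    refine ⟨⟨⟨r, d, hr⟩, ?_⟩⟩
    rintro ⟨g, k, hk⟩
    have hkL : k ∈ L := ⟨g, hk⟩
    rw [hd, AddSubgroup.mem_closure_singleton] at hkL
    obtain ⟨j, rfl⟩ := hkL
    refine ⟨j, Subtype.ext (hinj ?_)⟩
    change ι (r ^ j) x = ι g x
    have hfix : ((ρ ^ d)⁻¹ * ι r) x = x := by
      rw [Equiv.Perm.mul_apply, Equiv.Perm.inv_eq_iff_eq, hr]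
    have h1 := Equiv.Perm.zpow_apply_eq_self_of_apply_eq_self hfix j
    rw [(hcρ r d).symm.inv_left.mul_zpow, Equiv.Perm.mul_apply, inv_zpow,
      Equiv.Perm.inv_eq_iff_eq, ← zpow_mul] at h1
    rw [map_zpow, h1, hk, smul_eq_mul, mul_comm]
  · by_cases htop : C = ⊤
    · rw [htop, Subgroup.index_top]
      exact one_dvd 2
    · obtain ⟨s, hs⟩ : ∃ s, s ∉ C := by
        by_contra! h
        exact htop (by ext; simp [h])
      refine dvd_of_eq (Subgroup.index_eq_two_iff_exists_notMem_and.2 ⟨s, hs, fun g => ?_⟩)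
      by_cases hg : g ∈ C
      · exact Or.inr hg
      · obtain ⟨k, hk⟩ := hout hg
        obtain ⟨l, hl⟩ := hout hs
        exact Or.inl ⟨l - k, houtmul hk hl⟩
  -- The square of a reflection is trivial, so the square of `g` fixes `x`.
  · obtain ⟨k, hk⟩ := hout hg
    refine hfree _ ?_
    rw [houtmul hk hk]
    simp

namespace SurfaceMap

variable {Ω : Type*} (M : SurfaceMap Ω)

/-- An automorphism commutes with the group generated by the adjacency involutions, which is
transitive on flags. -/
theorem eq_one_of_apply_eq {g : M.aut} {x : Ω} (h : (g : Equiv.Perm Ω) x = x) : g = 1 := by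
  refine Subtype.ext (Equiv.ext fun y => ?_)
  obtain ⟨k, hk, rfl⟩ := M.connected x y
  rw [← Set.image_univ] at hk
  rw [M.aut_comm_closure g _ hk, h]
  rfl

/-- The action of the automorphism group on the cells of dimension `i`. -/
@[reducible]
def cellAction (i : Fin 3) : MulAction M.aut (M.Cell i) where
  smul g c := M.cellMap g i c
  one_smul c := by
    induction c using Quotient.inductionOn
    rfl
  mul_smul g h c := by
    induction c using Quotient.inductionOn
    rfl

/-- The flags of a fixed cell form one orbit of the group generated by the other two adjacency
involutions, and `P` acts on them freely. -/
theorem isDihedralType_of_cellMap_eq {P : Type*} [Group P] (f : P →* M.aut)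
    (hf : Function.Injective f) {i : Fin 3} {c : M.Cell i} (hc : ∀ g, M.cellMap (f g) i c = c) :
    IsDihedralType P := by
  induction c using Quotient.inductionOn with
  | _ x =>
  obtain ⟨j, k, hjk⟩ : ∃ j k : Fin 3, {l | l ≠ i} = ({j, k} : Set (Fin 3)) := by
    have : ∀ i : Fin 3, ∃ j k : Fin 3, ∀ l, l ≠ i ↔ l = j ∨ l = k := by decide
    obtain ⟨j, k, h⟩ := this i
    exact ⟨j, k, Set.ext h⟩
  have hinv (l : Fin 3) : M.s l * M.s l = 1 := Equiv.ext (M.invol l)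
  have hcomm (g : P) (l : Fin 3) : Commute (f g : Equiv.Perm Ω) (M.s l) :=
    Equiv.ext fun y => (f g).2 l y
  refine isDihedralType_of_free (M.aut.subtype.comp f) (hinv j) (hinv k) (fun g => hcomm g j)
    (fun g => hcomm g k) x (fun g hg => hf ?_) fun g => ?_
  · rw [map_one]
    exact M.eq_one_of_apply_eq hg
  · obtain ⟨⟨h, hh⟩, hx⟩ := Quotient.exact (hc g)
    rw [hjk, Set.image_pair] at hh
    exact ⟨h, hh, hx.symm⟩

theorem hasDihedralTypeSylows [Finite Ω] (hcop : Int.gcd (M.numEdges : ℤ) M.eulerChar = 1)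
    (G : Subgroup M.aut) : HasDihedralTypeSylows G := by
  intro p hp P
  have : Fact p.Prime := ⟨hp⟩
  have hfin (i : Fin 3) : Finite (M.Cell i) := Quotient.finite _
  -- This is where coprimality enters: a prime dividing all three cell numbers divides |E| and χ.
  obtain ⟨i, hi⟩ : ∃ i : Fin 3, ¬ p ∣ Nat.card (M.Cell i) := by
    by_contra! h
    have hz (i : Fin 3) : (p : ℤ) ∣ (Nat.card (M.Cell i) : ℤ) := Int.natCast_dvd_natCast.2 (h i)
    have h1 : (p : ℤ) ∣ M.eulerChar := dvd_add (dvd_sub (hz 0) (hz 1)) (hz 2)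
    have h2 : (p : ℤ) ∣ (M.numEdges : ℤ) := hz 1
    have h3 := Int.dvd_coe_gcd h2 h1
    rw [hcop] at h3
    exact hp.one_lt.ne' (Nat.dvd_one.1 (Int.natCast_dvd_natCast.1 h3))
  let f : P →* M.aut := G.subtype.comp (P : Subgroup G).subtype
  let _ : MulAction M.aut (M.Cell i) := M.cellAction i
  let _ : MulAction P (M.Cell i) := MulAction.compHom _ f
  obtain ⟨c, hc⟩ := P.2.nonempty_fixed_point_of_prime_not_dvd_card (M.Cell i) hi
  exact M.isDihedralType_of_cellMap_eq f
    (G.subtype_injective.comp (P : Subgroup G).subtype_injective) (c := c) hc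

end SurfaceMap

/-! ### The classification and the theorem -/

theorem HasDihedralTypeSylows.classification {G : Type*} [Group G] [Finite G]
    (hsol : Group.IsSolvable G) (hG : HasDihedralTypeSylows G) :
    (∃ n m : ℕ, 0 < n ∧ 0 < m ∧ Nat.gcd m n = 1 ∧ IsSplitExtension G (Cyc n) (Cyc m)) ∨
    (∃ n m e : ℕ, 2 ≤ e ∧ Nat.gcd m n = 1 ∧ Odd (m * n) ∧
      IsSplitExtension G (Cyc n) (DihedralGroup (2 ^ (e - 1)) × Cyc m)) ∨
    (∃ n m : ℕ, Nat.gcd m n = 1 ∧ Odd (m * n) ∧ 3 ∣ m ∧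
      IsSplitExtension G (Cyc n × DihedralGroup 2) (Cyc m) ∧
      ∃ φ : G →* alternatingGroup (Fin 4), Function.Surjective φ) ∨
    (∃ n m f : ℕ, 1 ≤ f ∧ Nat.gcd m n = 1 ∧ Odd (m * n) ∧
      IsSplitExtension G (Cyc n × DihedralGroup 2) (DihedralGroup (3 ^ f) × Cyc m) ∧
      ∃ φ : G →* Equiv.Perm (Fin 4), Function.Surjective φ) := by
  by_cases hZ : IsZGroup G
  · exact Or.inl (IsZGroup.exists_isSplitExtension G)
  rcases HasDihedralTypeSylows.normal_dichotomy _ rfl hsol hG with h2 | ⟨V, hV⟩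
  · exact Or.inr (Or.inl (h2.exists_isSplitExtension hG hZ))
  have : Fact (Nat.Prime 2) := ⟨Nat.prime_two⟩
  have hn := hV.1
  let S : Sylow 2 G := default
  have hVS : V ≤ S := (Subgroup.isPGroup_two_of_card_eq_four hV.2.1).le_sylow_of_normal S
  have hSi : Odd (S : Subgroup G).index := by
    rw [← Nat.not_even_iff_odd, even_iff_two_dvd]
    exact S.not_dvd_index
  have hmul : Nat.card (S : Subgroup G) * (S : Subgroup G).index = 4 * V.index := by
    rw [← hV.2.1, V.card_mul_index, Subgroup.card_mul_index]
  rcases hV.card_sylow hVS (hG 2 Nat.prime_two S) with h | ⟨h, s, hs, hsV⟩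
  · rw [h] at hmul
    refine Or.inr (Or.inr (Or.inl (hV.three_case hG ?_)))
    rwa [← Nat.eq_of_mul_eq_mul_left four_pos hmul]
  · rw [h] at hmul
    refine Or.inr (Or.inr (Or.inr (hV.six_case hG hSi (by omega) ?_)))
    -- If the centraliser of `V` had odd index it would contain every 2-element, in particular `s`.
    by_contra h2
    refine hsV (Subgroup.mem_of_coprime_index _ ?_)
    obtain ⟨j, hj⟩ := IsPGroup.iff_orderOf.1 S.2 ⟨s, hs⟩
    rw [Subgroup.orderOf_mk] at hj
    rw [hj]
    exact Nat.Coprime.pow_left j ((Nat.Prime.coprime_iff_not_dvd Nat.prime_two).2 h2)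

theorem theorem1p3 {Ω : Type*} [Finite Ω] (M : SurfaceMap Ω)
    (hcop : Int.gcd (M.numEdges : ℤ) M.eulerChar = 1)
    (G : Subgroup M.aut) (hsol : Group.IsSolvable G) (htrans : M.IsEdgeTransitive G) :
    (∃ n m : ℕ, 0 < n ∧ 0 < m ∧ (Nat.gcd m n = 1 ∨ Nat.gcd m n = 2) ∧
      IsSplitExtension G (Cyc n) (Cyc m)) ∨
    (∃ n m e : ℕ, 2 ≤ e ∧ Nat.gcd m n = 1 ∧ Odd (m * n) ∧
      IsSplitExtension G (Cyc n) (DihedralGroup (2 ^ (e - 1)) × Cyc m)) ∨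
    (∃ n m : ℕ, Nat.gcd m n = 1 ∧ Odd (m * n) ∧ 3 ∣ m ∧
      IsSplitExtension G (Cyc n × DihedralGroup 2) (Cyc m) ∧
      ∃ φ : G →* alternatingGroup (Fin 4), Function.Surjective φ) ∨
    (∃ n m f : ℕ, 1 ≤ f ∧ Nat.gcd m n = 1 ∧ Odd (m * n) ∧
      IsSplitExtension G (Cyc n × DihedralGroup 2) (DihedralGroup (3 ^ f) × Cyc m) ∧
      ∃ φ : G →* Equiv.Perm (Fin 4), Function.Surjective φ) := by
  refine (HasDihedralTypeSylows.classification hsol (M.hasDihedralTypeSylows hcop G)).imp_left ?_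
  rintro ⟨n, m, hn, hm, h1, h⟩
  -- In case (1) the argument always produces coprime orders.
  exact ⟨n, m, hn, hm, Or.inl h1, h⟩
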